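/- Let $\mathfrak g$ be a real Lie algebra, let $\Lambda^k\mathfrak g^*$ be the space of alternating $k$-forms on it, and let $d$ be the Chevalley--Eilenberg differential, so that $d\alpha(X,Y)=-\alpha([X,Y])$ for $\alpha\in\mathfrak g^*$. An $SU(2)$-structure on a $5$-dimensional $\mathfrak g$ is a quadruple $(\eta,\omega_1,\omega_2,\omega_3)$ with $0\neq\eta\in\mathfrak g^*$ and $\omega_i\in\Lambda^2\mathfrak g^*$ such that $\omega_i\wedge\omega_j=\delta_{ij}v$ and $v\wedge\eta\neq0$ for some nonzero $v\in\Lambda^4\mathfrak g^*$, and such that $\omega_2(X,Y)\ge 0$ whenever $i_X\omega_3=i_Y\omega_1$ (where $i_X$ is contraction by $X$). It is called hypo-contact if $$d\eta=-2\omega_3,\qquad d(\eta\wedge\omega_1)=0,\qquad d(\eta\wedge\omega_2)=0 .$$ **Theorem.** A $5$-dimensional solvable real Lie algebra admits a hypo-contact structure if and only if it is isomorphic to one of the following Lie algebras with basis $X_1,\dots,X_5$ (brackets of basis vectors that do not follow from the listed ones by antisymmetry are zero): $$ \begin{array}{rcl} \mathfrak h_{1} &:& [X_1,X_4]=[X_2,X_3]=X_5;\\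 \mathfrak h_{2} &:& \tfrac12[X_1,X_5]=[X_2,X_3]=X_1,\ [X_2,X_5]=X_2,\ [X_3,X_5]=X_3,\ [X_4,X_5]=-3X_4;\\ \mathfrak h_{3} &:& \tfrac12[X_1,X_4]=[X_2,X_3]=X_1,\ [X_2,X_4]=[X_3,X_5]=X_2,\ [X_2,X_5]=-[X_3,X_4]=-X_3;\\ \mathfrak h_{4} &:& [X_1,X_4]=X_1,\ [X_2,X_5]=X_2,\ [X_3,X_4]=[X_3,X_5]=-X_3;\\ \mathfrak h_{5} &:& [X_1,X_5]=[X_2,X_4]=X_1,\ [X_3,X_4]=X_2,\ [X_3,X_5]=-X_3,\ [X_4,X_5]=X_4. \end{array} $$ All five Lie algebras are solvable; among them $\mathfrak h_1$ is the only nilpotent one, and $\mathfrak h_2,\dots,\mathfrak h_5$ have trivial center. -/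

import Mathlib

/-! ### Invariant differential forms on a real Lie algebra

An alternating `k`-linear form on a Lie algebra `L` is the same as a left-invariant `k`-form on a Lie
group with Lie algebra `L`. -/

/-- The wedge product `(a ∧ b)(v) = ∑ sign(σ) a(v_{σ 0}, …) b(v_{σ m}, …)`, the sum being over the
`(m, n)`-shuffles `σ`. -/
noncomputable def wedge {L : Type*} [AddCommGroup L] [Module ℝ L] {m n : ℕ}
    (a : L [⋀^Fin m]→ₗ[ℝ] ℝ) (b : L [⋀^Fin n]→ₗ[ℝ] ℝ) : L [⋀^Fin (m + n)]→ₗ[ℝ] ℝ :=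
  ((LinearMap.mul' ℝ ℝ).compAlternatingMap (a.domCoprod b)).domDomCongr finSumFinEquiv

/-- The exterior derivative of an invariant form of positive degree (the Chevalley-Eilenberg
differential with trivial coefficients):
`(dα)(v) = ∑_{i < j} (-1)^(i+j) α([v_i, v_j], v_0, …, v̂_i, …, v̂_j, …)`. The position of the second
removed entry is `i.succAbove j` in `v`, and `j` once the entry `i` is removed. -/
noncomputable def extD {L : Type*} [LieRing L] [LieAlgebra ℝ L] {n : ℕ}
    (α : L [⋀^Fin (n + 1)]→ₗ[ℝ] ℝ) (v : Fin (n + 2) → L) : ℝ :=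
  ∑ i : Fin (n + 2), ∑ j : Fin (n + 1),
    if i < i.succAbove j then
      (-1 : ℝ) ^ ((i : ℕ) + (i.succAbove j : ℕ)) *
        α (Fin.cons (α := fun _ => L) ⁅v i, v (i.succAbove j)⁆ (j.removeNth (i.removeNth v)))
    else 0

/-- An `SU(2)`-structure `(η, ω₁, ω₂, ω₃)` on a Lie algebra; `ω 0`, `ω 1`, `ω 2` are
`ω₁`, `ω₂`, `ω₃`. -/
structure SU2Structure (L : Type*) [LieRing L] [LieAlgebra ℝ L] where
  η : L [⋀^Fin 1]→ₗ[ℝ] ℝ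
  ω : Fin 3 → L [⋀^Fin 2]→ₗ[ℝ] ℝ
  eta_ne_zero : η ≠ 0
  wedge_eq : ∃ v : L [⋀^Fin 4]→ₗ[ℝ] ℝ, v ≠ 0 ∧
    (∀ i j, wedge (ω i) (ω j) = if i = j then v else 0) ∧ wedge v η ≠ 0
  /-- `i_X ω₃ = i_Y ω₁` implies `ω₂(X, Y) ≥ 0`. -/
  nonneg : ∀ X Y : L, (∀ Z : L, ω 2 ![X, Z] = ω 0 ![Y, Z]) → 0 ≤ ω 1 ![X, Y]

/-- A hypo-contact structure: `dη = -2 ω₃`, `d(η ∧ ω₁) = 0`, `d(η ∧ ω₂) = 0`. -/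
structure HypoContactStructure (L : Type*) [LieRing L] [LieAlgebra ℝ L] extends
    SU2Structure L where
  d_eta : ∀ v : Fin 2 → L, extD η v = -2 * ω 2 v
  d_eta_wedge_one : ∀ v : Fin 4 → L, extD (n := 2) (wedge (m := 1) (n := 2) η (ω 0)) v = 0
  d_eta_wedge_two : ∀ v : Fin 4 → L, extD (n := 2) (wedge (m := 1) (n := 2) η (ω 1)) v = 0

/-! ### Five-dimensional Lie algebras given by the brackets of a basis -/

/-- The alternating bilinear product on `ℝ⁵` with `[X_i, X_j] = T i j` for `i < j`, where
`X_0, …, X_4` is the standard basis. The values `T i j` with `i ≥ j` are not used. -/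
def tableBracket (T : Fin 5 → Fin 5 → Fin 5 → ℝ) (x y : Fin 5 → ℝ) : Fin 5 → ℝ :=
  ∑ i : Fin 5, ∑ j : Fin 5, if i < j then (x i * y j - x j * y i) • T i j else 0

/-- A table of brackets `[X_i, X_j]`, `i < j`, that satisfies the Jacobi identity. -/
structure BracketTable where
  T : Fin 5 → Fin 5 → Fin 5 → ℝ
  jacobi : ∀ x y z : Fin 5 → ℝ, tableBracket T x (tableBracket T y z) =
    tableBracket T (tableBracket T x y) z + tableBracket T y (tableBracket T x z)

/-- The Lie algebra `ℝ⁵` with the bracket given by a table. -/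
def BracketTable.Algebra (_ : BracketTable) : Type := Fin 5 → ℝ

noncomputable instance (B : BracketTable) : AddCommGroup B.Algebra :=
  inferInstanceAs (AddCommGroup (Fin 5 → ℝ))

noncomputable instance (B : BracketTable) : Module ℝ B.Algebra :=
  inferInstanceAs (Module ℝ (Fin 5 → ℝ))

noncomputable instance (B : BracketTable) : LieRing B.Algebra where
  bracket := tableBracket B.T
  add_lie x y z := by
    change tableBracket B.T (fun i => x i + y i) z = tableBracket B.T x z + tableBracket B.T y z
    simp only [tableBracket, ← Finset.sum_add_distrib]
    refine Finset.sum_congr rfl fun i _ => Finset.sum_congr rfl fun j _ => ?_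
    split_ifs
    · rw [← add_smul]; congr 1; ring
    · simp
  lie_add x y z := by
    change tableBracket B.T x (fun i => y i + z i) = tableBracket B.T x y + tableBracket B.T x z
    simp only [tableBracket, ← Finset.sum_add_distrib]
    refine Finset.sum_congr rfl fun i _ => Finset.sum_congr rfl fun j _ => ?_
    split_ifs
    · rw [← add_smul]; congr 1; ring
    · simp
  lie_self x := by
    change tableBracket B.T x x = 0
    simp only [tableBracket]
    refine Finset.sum_eq_zero fun i _ => Finset.sum_eq_zero fun j _ => ?_
    split_ifs
    · rw [mul_comm, sub_self, zero_smul]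
    · rfl
  leibniz_lie x y z := B.jacobi x y z

noncomputable instance (B : BracketTable) : LieAlgebra ℝ B.Algebra where
  lie_smul t x y := by
    change tableBracket B.T x (fun i => t * y i) = t • tableBracket B.T x y
    simp only [tableBracket, Finset.smul_sum]
    refine Finset.sum_congr rfl fun i _ => Finset.sum_congr rfl fun j _ => ?_
    split_ifs
    · rw [smul_smul]; congr 1; ring
    · simp

/-- The standard basis vector `X_i` of `ℝ⁵`, numbered from `0`. -/
def stdVec (i : Fin 5) : Fin 5 → ℝ := Pi.single i 1

/-- Brackets `[X₁, X₄] = [X₂, X₃] = X₅`. As in the tables below, the indices in the code are one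
less than in the displayed formulas, and brackets that are not listed are zero. -/
def h1Table : Fin 5 → Fin 5 → Fin 5 → ℝ
  | 0, 3 => stdVec 4
  | 1, 2 => stdVec 4
  | _, _ => 0

/-- Brackets `½ [X₁, X₅] = [X₂, X₃] = X₁`, `[X₂, X₅] = X₂`, `[X₃, X₅] = X₃`,
`[X₄, X₅] = -3 X₄`. -/
def h2Table : Fin 5 → Fin 5 → Fin 5 → ℝ
  | 0, 4 => (2 : ℝ) • stdVec 0
  | 1, 2 => stdVec 0
  | 1, 4 => stdVec 1
  | 2, 4 => stdVec 2
  | 3, 4 => (-3 : ℝ) • stdVec 3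
  | _, _ => 0

/-- Brackets `½ [X₁, X₄] = [X₂, X₃] = X₁`, `[X₂, X₄] = [X₃, X₅] = X₂`,
`[X₂, X₅] = -[X₃, X₄] = -X₃`. -/
def h3Table : Fin 5 → Fin 5 → Fin 5 → ℝ
  | 0, 3 => (2 : ℝ) • stdVec 0
  | 1, 2 => stdVec 0
  | 1, 3 => stdVec 1
  | 2, 4 => stdVec 1
  | 1, 4 => -stdVec 2
  | 2, 3 => stdVec 2
  | _, _ => 0

/-- Brackets `[X₁, X₄] = X₁`, `[X₂, X₅] = X₂`, `[X₃, X₄] = [X₃, X₅] = -X₃`. -/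
def h4Table : Fin 5 → Fin 5 → Fin 5 → ℝ
  | 0, 3 => stdVec 0
  | 1, 4 => stdVec 1
  | 2, 3 => -stdVec 2
  | 2, 4 => -stdVec 2
  | _, _ => 0

/-- Brackets `[X₁, X₅] = [X₂, X₄] = X₁`, `[X₃, X₄] = X₂`, `[X₃, X₅] = -X₃`,
`[X₄, X₅] = X₄`. -/
def h5Table : Fin 5 → Fin 5 → Fin 5 → ℝ
  | 0, 4 => stdVec 0
  | 1, 3 => stdVec 0
  | 2, 3 => stdVec 1
  | 2, 4 => -stdVec 2
  | 3, 4 => stdVec 3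
  | _, _ => 0

theorem h1_bracket (x y : Fin 5 → ℝ) : tableBracket h1Table x y =
    ![0, 0, 0, 0, x 0 * y 3 - x 3 * y 0 + (x 1 * y 2 - x 2 * y 1)] := by
  funext k
  fin_cases k <;> simp [tableBracket, h1Table, stdVec, Fin.sum_univ_five]

theorem h2_bracket (x y : Fin 5 → ℝ) : tableBracket h2Table x y =
    ![2 * (x 0 * y 4 - x 4 * y 0) + (x 1 * y 2 - x 2 * y 1), x 1 * y 4 - x 4 * y 1,
      x 2 * y 4 - x 4 * y 2, -3 * (x 3 * y 4 - x 4 * y 3), 0] := by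
  funext k
  fin_cases k <;> simp [tableBracket, h2Table, stdVec, Fin.sum_univ_five] <;> ring

theorem h3_bracket (x y : Fin 5 → ℝ) : tableBracket h3Table x y =
    ![2 * (x 0 * y 3 - x 3 * y 0) + (x 1 * y 2 - x 2 * y 1),
      (x 1 * y 3 - x 3 * y 1) + (x 2 * y 4 - x 4 * y 2),
      -(x 1 * y 4 - x 4 * y 1) + (x 2 * y 3 - x 3 * y 2), 0, 0] := by
  funext k
  fin_cases k <;> simp [tableBracket, h3Table, stdVec, Fin.sum_univ_five] <;> ring

theorem h4_bracket (x y : Fin 5 → ℝ) : tableBracket h4Table x y =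
    ![x 0 * y 3 - x 3 * y 0, x 1 * y 4 - x 4 * y 1,
      -(x 2 * y 3 - x 3 * y 2) - (x 2 * y 4 - x 4 * y 2), 0, 0] := by
  funext k
  fin_cases k <;> simp [tableBracket, h4Table, stdVec, Fin.sum_univ_five] <;> ring

theorem h5_bracket (x y : Fin 5 → ℝ) : tableBracket h5Table x y =
    ![(x 0 * y 4 - x 4 * y 0) + (x 1 * y 3 - x 3 * y 1), x 2 * y 3 - x 3 * y 2,
      -(x 2 * y 4 - x 4 * y 2), x 3 * y 4 - x 4 * y 3, 0] := by
  funext k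
  fin_cases k <;> simp [tableBracket, h5Table, stdVec, Fin.sum_univ_five]

def h1 : BracketTable where
  T := h1Table
  jacobi x y z := by
    simp only [h1_bracket]
    funext k
    fin_cases k <;> simp

def h2 : BracketTable where
  T := h2Table
  jacobi x y z := by
    simp only [h2_bracket]
    funext k
    fin_cases k <;> simp <;> ring

def h3 : BracketTable where
  T := h3Table
  jacobi x y z := by
    simp only [h3_bracket]
    funext k
    fin_cases k <;> simp <;> ring

def h4 : BracketTable where
  T := h4Table
  jacobi x y z := by
    simp only [h4_bracket]
    funext k
    fin_cases k <;> simp <;> ring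

def h5 : BracketTable where
  T := h5Table
  jacobi x y z := by
    simp only [h5_bracket]
    funext k
    fin_cases k <;> simp <;> ring

/-! # Five-dimensional solvable Lie algebras with a hypo-contact structure

Let `ξ` be the Reeb vector of a hypo-contact structure: `η ξ = 1` and `ξ` lies in the kernel of
every `ω i`. On a solvable Lie algebra there is a nonzero closed linear form `α` with `α ξ = 0`
(`exists_closed_form`). Otherwise `[L, L]` would be a complement of `ξ`, so that `dη` is
nondegenerate on it; then some `u` in `[L, L]` has `η [u, y] = η y` on `[L, L]`, the endomorphism
`ad u` plus its `dη`-adjoint is the identity, and `ad u` has trace `2`, although `u` lies in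
`[L, L]`.

The vectors dual to `-α` under the three forms, together with `ξ` and a fifth vector, form after
rescaling an orthonormal frame (`BilinearSU2.exists_frame`); the sign condition in the definition
of an `SU(2)`-structure makes the scale factor positive. In this frame the hypo-contact equations
are linear in the structure constants and leave twelve parameters (`exists_adapted`). The Jacobi
identity expresses six of them by the other six, and a rotation of `ω₁`, `ω₂` diagonalizes what is
left, up to the entry `p` (`IsAdapted.exists_diagonal`). The remaining equations have six families
of solutions (`IsAdapted.cases_of_diagonal`). Those of rank one with `g ≠ 0` contain a simple
three-dimensional subalgebra. The family of trace zero is a pencil on which a rotation between the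
closed covectors acts by three times its angle, so that a cube root of `a + p i` reduces it to
`p = 0`. What remains are the five algebras, up to a scale that the change of basis absorbs.

Conversely every basis with the adapted brackets carries the hypo-contact structure written in its
dual basis (`IsAdapted.hypoContactStructure`), and each of the five algebras has such a basis. The
algebras `h2`, …, `h5` are not nilpotent because a nonzero nilpotent Lie algebra has a nonzero
center. -/

/-! ### Explicit formulas for wedge products and differentials in low degree -/

theorem wedge_apply {L : Type*} [AddCommGroup L] [Module ℝ L] {m n : ℕ}
    (a : L [⋀^Fin m]→ₗ[ℝ] ℝ) (b : L [⋀^Fin n]→ₗ[ℝ] ℝ) (v : Fin (m + n) → L) :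
    wedge a b v = LinearMap.mul' ℝ ℝ (a.domCoprod b fun i => v (finSumFinEquiv i)) :=
  rfl

/-- The wedge product as a sum over all permutations, each shuffle being counted `m! n!` times. -/
theorem factorial_mul_wedge_apply {L : Type*} [AddCommGroup L] [Module ℝ L] {m n : ℕ}
    (a : L [⋀^Fin m]→ₗ[ℝ] ℝ) (b : L [⋀^Fin n]→ₗ[ℝ] ℝ) (v : Fin (m + n) → L) :
    ((m.factorial * n.factorial : ℕ) : ℝ) * wedge a b v =
      ∑ σ : Equiv.Perm (Fin (m + n)), ((Equiv.Perm.sign σ : ℤ) : ℝ) *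
        (a (fun i => v (σ (Fin.castAdd n i))) * b (fun j => v (σ (Fin.natAdd m j)))) := by
  have h := congrArg
    (fun f => LinearMap.mul' ℝ ℝ (f (fun i => v (finSumFinEquiv i))))
    (MultilinearMap.domCoprod_alternization_eq a b)
  simp only [AlternatingMap.smul_apply, map_nsmul, Fintype.card_fin,
    MultilinearMap.alternatization_apply, map_sum] at h
  rw [wedge_apply, ← nsmul_eq_mul, ← h]
  refine Fintype.sum_equiv finSumFinEquiv.permCongr _ _ fun σ => ?_
  simp only [Units.smul_def, map_zsmul, MultilinearMap.domDomCongr_apply,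
    MultilinearMap.domCoprod_apply, AlternatingMap.coe_multilinearMap,
    Equiv.Perm.sign_permCongr, Equiv.permCongr_apply, ← finSumFinEquiv_apply_left,
    ← finSumFinEquiv_apply_right, Equiv.symm_apply_apply]
  rcases Int.units_eq_one_or (Equiv.Perm.sign σ) with hσ | hσ <;> simp [hσ]

open Equiv Equiv.Perm in
theorem sum_sign_mul_perm_three (G : Fin 3 → Fin 3 → Fin 3 → ℝ) :
    ∑ σ : Perm (Fin 3), ((sign σ : ℤ) : ℝ) * G (σ 0) (σ 1) (σ 2) =
      G 0 1 2 - G 0 2 1 - G 1 0 2 + G 1 2 0 - G 2 1 0 + G 2 0 1 := by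
  have e (p) (τ : Perm (Fin 2)) : decomposeFin.symm (p, τ) 2 = swap 0 p (τ 1).succ :=
    decomposeFin_symm_apply_succ τ p 1
  simp only [Finset.univ_perm_fin_succ, Finset.sum_map, ← Finset.univ_product_univ,
    Finset.sum_product, Fin.sum_univ_two, Fin.sum_univ_three, Finset.univ_unique,
    Finset.sum_singleton, Equiv.coe_toEmbedding, decomposeFin.symm_sign,
    decomposeFin_symm_apply_zero, decomposeFin_symm_apply_one, e]
  simp [swap_apply_def]
  ring

open Equiv Equiv.Perm in
theorem sum_sign_mul_perm_four (G : Fin 4 → Fin 4 → Fin 4 → Fin 4 → ℝ) :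
    ∑ σ : Perm (Fin 4), ((sign σ : ℤ) : ℝ) * G (σ 0) (σ 1) (σ 2) (σ 3) =
      G 0 1 2 3 - G 0 1 3 2 - G 0 2 1 3 + G 0 2 3 1 - G 0 3 2 1 + G 0 3 1 2
      - G 1 0 2 3 + G 1 0 3 2 + G 1 2 0 3 - G 1 2 3 0 + G 1 3 2 0 - G 1 3 0 2
      - G 2 1 0 3 + G 2 1 3 0 + G 2 0 1 3 - G 2 0 3 1 + G 2 3 0 1 - G 2 3 1 0
      - G 3 1 2 0 + G 3 1 0 2 + G 3 2 1 0 - G 3 2 0 1 + G 3 0 2 1 - G 3 0 1 2 := by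
  have e (p) (τ : Perm (Fin 2)) : decomposeFin.symm (p, τ) 2 = swap 0 p (τ 1).succ :=
    decomposeFin_symm_apply_succ τ p 1
  have e2 (p) (τ : Perm (Fin 3)) : decomposeFin.symm (p, τ) 2 = swap 0 p (τ 1).succ :=
    decomposeFin_symm_apply_succ τ p 1
  have e3 (p) (τ : Perm (Fin 3)) : decomposeFin.symm (p, τ) 3 = swap 0 p (τ 2).succ :=
    decomposeFin_symm_apply_succ τ p 2
  simp only [Finset.univ_perm_fin_succ, Finset.sum_map, ← Finset.univ_product_univ,
    Finset.sum_product, Fin.sum_univ_two, Fin.sum_univ_three, Fin.sum_univ_four,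
    Finset.univ_unique, Finset.sum_singleton, Equiv.coe_toEmbedding, decomposeFin.symm_sign,
    decomposeFin_symm_apply_zero, decomposeFin_symm_apply_one, e, e2, e3]
  simp [swap_apply_def]
  ring

theorem alternating_two_swap {L : Type*} [AddCommGroup L] [Module ℝ L]
    (b : L [⋀^Fin 2]→ₗ[ℝ] ℝ) (s t : L) : b ![s, t] = - b ![t, s] := by
  have := b.map_swap ![t, s] (show (0 : Fin 2) ≠ 1 by decide)
  rw [← this]
  congr 1
  funext i
  fin_cases i <;> rfl

theorem fin_one_eta {L : Type*} (w : Fin 1 → L) : w = ![w 0] := by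
  funext i; fin_cases i; rfl

theorem fin_two_eta {L : Type*} (w : Fin 2 → L) : w = ![w 0, w 1] := by
  funext i; fin_cases i <;> rfl

theorem wedge_one_two_apply {L : Type*} [AddCommGroup L] [Module ℝ L]
    (a : L [⋀^Fin 1]→ₗ[ℝ] ℝ) (b : L [⋀^Fin 2]→ₗ[ℝ] ℝ) (v : Fin 3 → L) :
    wedge (m := 1) (n := 2) a b v = a ![v 0] * b ![v 1, v 2] - a ![v 1] * b ![v 0, v 2] +
      a ![v 2] * b ![v 0, v 1] := by
  have h := factorial_mul_wedge_apply a b v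
  simp only [fin_one_eta fun i : Fin 1 => v _, fin_two_eta fun i : Fin 2 => v _] at h
  have h' := sum_sign_mul_perm_three (fun i j k => a ![v i] * b ![v j, v k])
  have h'' : _ = _ := h.trans h'
  rw [alternating_two_swap b (v 2) (v 1), alternating_two_swap b (v 2) (v 0),
    alternating_two_swap b (v 1) (v 0)] at h''
  norm_num [Nat.factorial] at h''
  linarith

theorem wedge_two_two_apply {L : Type*} [AddCommGroup L] [Module ℝ L]
    (a b : L [⋀^Fin 2]→ₗ[ℝ] ℝ) (v : Fin 4 → L) :
    wedge (m := 2) (n := 2) a b v =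
      a ![v 0, v 1] * b ![v 2, v 3] - a ![v 0, v 2] * b ![v 1, v 3] +
      a ![v 0, v 3] * b ![v 1, v 2] + a ![v 1, v 2] * b ![v 0, v 3] -
      a ![v 1, v 3] * b ![v 0, v 2] + a ![v 2, v 3] * b ![v 0, v 1] := by
  have h := factorial_mul_wedge_apply a b v
  simp only [fin_two_eta fun i : Fin 2 => v _] at h
  have h' := sum_sign_mul_perm_four (fun i j k l => a ![v i, v j] * b ![v k, v l])
  have h'' : _ = _ := h.trans h'
  have key (c : L [⋀^Fin 2]→ₗ[ℝ] ℝ) := And.intro (alternating_two_swap c (v 1) (v 0))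
    <| And.intro (alternating_two_swap c (v 2) (v 0))
    <| And.intro (alternating_two_swap c (v 3) (v 0))
    <| And.intro (alternating_two_swap c (v 2) (v 1))
    <| And.intro (alternating_two_swap c (v 3) (v 1)) <| alternating_two_swap c (v 3) (v 2)
  obtain ⟨a1, a2, a3, a4, a5, a6⟩ := key a
  obtain ⟨b1, b2, b3, b4, b5, b6⟩ := key b
  rw [a1, a2, a3, a4, a5, a6, b1, b2, b3, b4, b5, b6] at h''
  norm_num [Nat.factorial] at h''
  linarith

/-- If the contractions of a `1`-form `b` and a `4`-form `a` with a vector `x` vanish, then `a ∧ b`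
vanishes on all tuples that contain `x`. -/
theorem wedge_four_one_eq_zero_of_contract {L : Type*} [AddCommGroup L] [Module ℝ L]
    (a : L [⋀^Fin 4]→ₗ[ℝ] ℝ) (b : L [⋀^Fin 1]→ₗ[ℝ] ℝ) (x : L) (hb : b ![x] = 0)
    (ha : ∀ w : Fin 4 → L, ∀ i, w i = x → a w = 0) (u : Fin 5 → L) (i : Fin 5) (hi : u i = x) :
    wedge (m := 4) (n := 1) a b u = 0 := by
  have h := factorial_mul_wedge_apply a b u
  rw [Finset.sum_eq_zero] at h
  · have : ((Nat.factorial 4 * Nat.factorial 1 : ℕ) : ℝ) ≠ 0 := by norm_num [Nat.factorial]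
    exact (mul_eq_zero.mp h).resolve_left this
  intro σ _
  refine mul_eq_zero_of_right _ ?_
  obtain ⟨j, rfl⟩ := σ.surjective i
  revert hi
  refine Fin.addCases (m := 4) (n := 1) (fun k hi => ?_) (fun k hi => ?_) j
  · rw [ha _ k hi, zero_mul]
  · rw [fin_one_eta fun j => u (σ (Fin.natAdd 4 j)), Subsingleton.elim 0 k, hi, hb, mul_zero]

/-- If the `1`-form vanishes on the first four entries, then only one shuffle contributes. -/
theorem wedge_four_one_apply_of_eq_zero {L : Type*} [AddCommGroup L] [Module ℝ L]
    (a : L [⋀^Fin 4]→ₗ[ℝ] ℝ) (b : L [⋀^Fin 1]→ₗ[ℝ] ℝ) (u : Fin 5 → L)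
    (hb : ∀ i : Fin 4, b ![u i.castSucc] = 0) :
    wedge (m := 4) (n := 1) a b u = a (fun i => u i.castSucc) * b ![u 4] := by
  rw [wedge_apply, ← AlternatingMap.coe_multilinearMap, AlternatingMap.domCoprod_coe, sum_apply]
  refine (congrArg _ (Fintype.sum_eq_single (Quotient.mk'' 1) ?_)).trans ?_
  · intro σ hσ
    induction σ using Quotient.inductionOn' with | _ σ
    rw [AlternatingMap.domCoprod.summand_mk'']
    rcases hs : σ (Sum.inr 0) with k | k
    · have : b (fun j => u (finSumFinEquiv (σ (Sum.inr j)))) = 0 := by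
        rw [fin_one_eta fun i : Fin 1 => u _, hs]
        exact hb k
      simp [this]
    · refine absurd (Quotient.sound' ?_) hσ
      rw [QuotientGroup.leftRel_apply, mul_one]
      refine inv_mem (Equiv.Perm.mem_sumCongrHom_range_of_perm_mapsTo_inl
        ((Equiv.Perm.perm_mapsTo_inl_iff_mapsTo_inr σ).mpr ?_))
      rintro _ ⟨j, rfl⟩
      exact ⟨k, by rw [← hs, Subsingleton.elim j 0]⟩
  · rw [AlternatingMap.domCoprod.summand_mk'']
    simp only [Equiv.Perm.sign_one, one_smul, MultilinearMap.domDomCongr_apply,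
      MultilinearMap.domCoprod_apply, AlternatingMap.coe_multilinearMap, LinearMap.mul'_apply,
      Equiv.Perm.coe_one, id_eq]
    rw [fin_one_eta fun i : Fin 1 => u _]
    rfl

theorem extD_one_apply {L : Type*} [LieRing L] [LieAlgebra ℝ L] (α : L [⋀^Fin 1]→ₗ[ℝ] ℝ)
    (v : Fin 2 → L) : extD α v = - α ![⁅v 0, v 1⁆] := by
  change (∑ i : Fin 2, ∑ j : Fin 1, if i < i.succAbove j then
    (-1 : ℝ) ^ ((i : ℕ) + (i.succAbove j : ℕ)) * α (Fin.cons (α := fun _ => L)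
      ⁅v i, v (i.succAbove j)⁆ (j.removeNth (i.removeNth v))) else 0) = _
  have key (j : Fin 1) (w : Fin 1 → L) (z : L) :
      α (Fin.cons (α := fun _ => L) z (j.removeNth w)) = α ![z] := by
    congr 1
    funext k
    fin_cases k
    rfl
  simp only [Fin.sum_univ_two, Finset.univ_unique, Finset.sum_singleton, key]
  simp

theorem extD_three_apply {L : Type*} [LieRing L] [LieAlgebra ℝ L] (α : L [⋀^Fin 3]→ₗ[ℝ] ℝ)
    (v : Fin 4 → L) : extD α v =
      - α ![⁅v 0, v 1⁆, v 2, v 3] + α ![⁅v 0, v 2⁆, v 1, v 3] - α ![⁅v 0, v 3⁆, v 1, v 2]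
      - α ![⁅v 1, v 2⁆, v 0, v 3] + α ![⁅v 1, v 3⁆, v 0, v 2] - α ![⁅v 2, v 3⁆, v 0, v 1] := by
  have key (i : Fin 4) (j : Fin 3) (x y : L) (hx : i.removeNth v (j.succAbove 0) = x)
      (hy : i.removeNth v (j.succAbove 1) = y) (z : L) :
      α (Fin.cons (α := fun _ => L) z (j.removeNth (i.removeNth v))) = α ![z, x, y] := by
    congr 1
    funext k
    fin_cases k
    exacts [rfl, hx, hy]
  change (∑ i : Fin 4, ∑ j : Fin 3, if i < i.succAbove j then
    (-1 : ℝ) ^ ((i : ℕ) + (i.succAbove j : ℕ)) * α (Fin.cons (α := fun _ => L)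
      ⁅v i, v (i.succAbove j)⁆ (j.removeNth (i.removeNth v))) else 0) = _
  simp only [Fin.sum_univ_four, Fin.sum_univ_three]
  rw [key 0 0 (v 2) (v 3) rfl rfl, key 0 1 (v 1) (v 3) rfl rfl, key 0 2 (v 1) (v 2) rfl rfl,
    key 1 1 (v 0) (v 3) rfl rfl, key 1 2 (v 0) (v 2) rfl rfl, key 2 2 (v 0) (v 1) rfl rfl]
  simp [Fin.succAbove, Fin.lt_def]
  ring

/-! ### Linear algebra of an `SU(2)`-structure -/

/-- The value at `(x, y, z, t)` of the wedge product of two skew-symmetric bilinear forms. -/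
def wedgeForm {L : Type*} [AddCommGroup L] [Module ℝ L] (a b : L →ₗ[ℝ] L →ₗ[ℝ] ℝ)
    (x y z t : L) : ℝ :=
  a x y * b z t - a x z * b y t + a x t * b y z + a y z * b x t - a y t * b x z + a z t * b x y

/-- An `SU(2)`-structure written with a linear form `e` in place of `η` and bilinear forms `w i` in
place of the `ω i`. The condition `nondeg` replaces `v ∧ η ≠ 0`. -/
structure BilinearSU2 (L : Type*) [AddCommGroup L] [Module ℝ L] where
  e : L →ₗ[ℝ] ℝ
  w : Fin 3 → L →ₗ[ℝ] L →ₗ[ℝ] ℝ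
  skew : ∀ i x y, w i x y = - w i y x
  wedge_eq : ∀ i j x y z t,
    wedgeForm (w i) (w j) x y z t = if i = j then wedgeForm (w 2) (w 2) x y z t else 0
  nondeg : ∀ x, e x = 0 → (∀ y z t, wedgeForm (w 2) (w 2) x y z t = 0) → x = 0
  nonneg : ∀ x y, (∀ z, w 2 x z = w 0 y z) → 0 ≤ w 1 x y

/-- An alternating `1`-form as a linear form. -/
def oneFormLin {L : Type*} [AddCommGroup L] [Module ℝ L] (a : L [⋀^Fin 1]→ₗ[ℝ] ℝ) : L →ₗ[ℝ] ℝ where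
  toFun x := a ![x]
  map_add' x y := a.map_vecCons_add ![] x y
  map_smul' c x := a.map_vecCons_smul ![] c x

/-- An alternating `2`-form as a bilinear form. -/
def twoFormBilin {L : Type*} [AddCommGroup L] [Module ℝ L] (a : L [⋀^Fin 2]→ₗ[ℝ] ℝ) :
    L →ₗ[ℝ] L →ₗ[ℝ] ℝ :=
  LinearMap.mk₂ ℝ (fun x y => a ![x, y])
    (fun x x' y => a.map_vecCons_add ![y] x x')
    (fun c x y => a.map_vecCons_smul ![y] c x)
    (fun x y y' => by
      rw [alternating_two_swap a x, alternating_two_swap a x, alternating_two_swap a x,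
        a.map_vecCons_add ![x] y y', neg_add])
    (fun c x y => by
      rw [alternating_two_swap a x, alternating_two_swap a x, a.map_vecCons_smul ![x] c y,
        smul_neg])

theorem wedge_two_two_eq_wedgeForm {L : Type*} [AddCommGroup L] [Module ℝ L]
    (a b : L [⋀^Fin 2]→ₗ[ℝ] ℝ) (v : Fin 4 → L) :
    wedge (m := 2) (n := 2) a b v =
      wedgeForm (twoFormBilin a) (twoFormBilin b) (v 0) (v 1) (v 2) (v 3) :=
  wedge_two_two_apply a b v

/-- On a `5`-dimensional space, `a ∧ b ≠ 0` implies that the kernels of `a` and `b` meet in zero. -/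
theorem eq_zero_of_wedge_four_one_ne_zero {L : Type*} [AddCommGroup L] [Module ℝ L]
    (hdim : Module.finrank ℝ L = 5)
    (a : L [⋀^Fin 4]→ₗ[ℝ] ℝ) (b : L [⋀^Fin 1]→ₗ[ℝ] ℝ) (hab : wedge (m := 4) (n := 1) a b ≠ 0)
    (x : L) (hb : b ![x] = 0) (ha : ∀ y z t, a ![x, y, z, t] = 0) : x = 0 := by
  have : Module.Finite ℝ L := Module.finite_of_finrank_eq_succ hdim
  by_contra hx
  apply hab
  have hli : LinearIndepOn ℝ id ({x} : Set L) := LinearIndepOn.singleton (v := id) hx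
  let B := Module.Basis.extend hli
  have hmem : x ∈ hli.extend (Set.subset_univ _) := hli.subset_extend _ (Set.mem_singleton x)
  have : Fintype (hli.extend (Set.subset_univ _)) := FiniteDimensional.fintypeBasisIndex B
  refine B.ext_alternating fun v hv => ?_
  have hbij : Function.Bijective v := by
    refine (Fintype.bijective_iff_injective_and_card v).mpr ⟨hv, ?_⟩
    rw [← Module.finrank_eq_card_basis B, hdim]
    rfl
  obtain ⟨i, hi⟩ := hbij.surjective ⟨x, hmem⟩
  refine wedge_four_one_eq_zero_of_contract a b x hb ?_ _ i ?_
  · have h0 (w : Fin 4 → L) (h : w 0 = x) : a w = 0 := by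
      rw [← ha (w 1) (w 2) (w 3)]
      congr 1
      funext k
      fin_cases k <;> simp [h]
    intro w j hj
    by_cases h : (0 : Fin 4) = j
    · exact h0 w (h ▸ hj)
    · have := a.map_swap w h
      rw [h0 _ (by simp [hj])] at this
      linarith
  · rw [hi]
    simp [B]

/-- The linear-algebra data of an `SU(2)`-structure. -/
def SU2Structure.toBilinearSU2 {L : Type*} [LieRing L] [LieAlgebra ℝ L]
    (hdim : Module.finrank ℝ L = 5) (S : SU2Structure L) : BilinearSU2 L where
  e := oneFormLin S.η
  w i := twoFormBilin (S.ω i)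
  skew i := alternating_two_swap (S.ω i)
  wedge_eq i j x y z t := by
    obtain ⟨v, -, h, -⟩ := S.wedge_eq
    have h1 := congrArg (fun f => f ![x, y, z, t]) (h i j)
    have h2 := congrArg (fun f => f ![x, y, z, t]) (h 2 2)
    simp only [wedge_two_two_eq_wedgeForm, if_true] at h1 h2
    refine h1.trans ?_
    split_ifs
    · exact h2.symm
    · rfl
  nondeg x hx h := by
    obtain ⟨v, -, hw, hv⟩ := S.wedge_eq
    refine eq_zero_of_wedge_four_one_ne_zero hdim v S.η hv x hx fun y z t => ?_
    rw [← if_pos (rfl : (2 : Fin 3) = 2) (t := v) (e := 0), ← hw 2 2, wedge_two_two_eq_wedgeForm]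
    exact h y z t
  nonneg x y h := S.nonneg x y h

namespace BilinearSU2

variable {L : Type*} [AddCommGroup L] [Module ℝ L]

theorem exists_ker_of_skew (hdim : Module.finrank ℝ L = 5) (a : L →ₗ[ℝ] L →ₗ[ℝ] ℝ)
    (ha : ∀ x y, a x y = - a y x) : ∃ x ≠ 0, ∀ y, a x y = 0 := by
  have : Module.Finite ℝ L := Module.finite_of_finrank_eq_succ hdim
  by_contra! hcon
  let B := Module.finBasisOfFinrankEq ℝ L hdim
  let A : Matrix (Fin 5) (Fin 5) ℝ := Matrix.of fun i j => a (B i) (B j)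
  have hA : A.det = 0 := by
    have h : A.transpose = -A := by
      ext i j
      exact ha _ _
    have h2 := congrArg Matrix.det h
    rw [Matrix.det_transpose, Matrix.det_neg, Fintype.card_fin] at h2
    linarith
  obtain ⟨c, hc, h⟩ := Matrix.exists_vecMul_eq_zero_iff.mpr hA
  have hx : ∑ i, c i • B i ≠ 0 := fun h0 =>
    hc (funext fun i => Fintype.linearIndependent_iff.mp B.linearIndependent c h0 i)
  obtain ⟨y, hy⟩ := hcon _ hx
  apply hy
  have : a (∑ i, c i • B i) = 0 := by
    refine B.ext fun j => ?_
    have := congrFun h j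
    simpa [Matrix.vecMul, dotProduct, A] using this
  rw [this, LinearMap.zero_apply]

variable (S : BilinearSU2 L)

theorem self (i : Fin 3) (x : L) : S.w i x x = 0 := by
  have := S.skew i x x
  linarith

/-- A decomposable form `θ ∧ φ` has square zero. -/
theorem wedgeForm_self_of_decomposable {a : L →ₗ[ℝ] L →ₗ[ℝ] ℝ} {θ φ : L →ₗ[ℝ] ℝ}
    (h : ∀ y z, a y z = θ y * φ z - θ z * φ y) (x y z t : L) : wedgeForm a a x y z t = 0 := by
  simp only [wedgeForm, h]
  ring

/-- The forms have the same kernel: if `i_ξ ω₃ = 0` but `i_ξ ωᵢ ≠ 0`, then contracting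
`ωᵢ ∧ ωᵢ = ω₃ ∧ ω₃` with `ξ` would show that `ωᵢ` is decomposable, so that `ωᵢ ∧ ωᵢ = 0`. -/
theorem contract_eq_zero (i : Fin 3) (ξ : L) (h : ∀ y, S.w 2 ξ y = 0)
    (hne : ∃ x y z t, wedgeForm (S.w 2) (S.w 2) x y z t ≠ 0) (y : L) : S.w i ξ y = 0 := by
  by_contra hy
  obtain ⟨x₁, x₂, x₃, x₄, hx⟩ := hne
  apply hx
  have h1 := S.wedge_eq i i x₁ x₂ x₃ x₄
  rw [if_pos rfl] at h1
  rw [← h1]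
  refine wedgeForm_self_of_decomposable (θ := S.w i ξ) (φ := (S.w i ξ y)⁻¹ • S.w i y)
    (fun s t => ?_) _ _ _ _
  have h2 := S.wedge_eq i i ξ y s t
  rw [if_pos rfl] at h2
  simp only [wedgeForm, h] at h2
  have h3 : S.w i ξ y * S.w i s t = S.w i ξ s * S.w i y t - S.w i ξ t * S.w i y s := by linarith
  simp only [LinearMap.smul_apply, smul_eq_mul]
  field_simp
  linarith

theorem exists_reeb (hdim : Module.finrank ℝ L = 5) :
    ∃ ξ, S.e ξ = 1 ∧ ∀ i x, S.w i ξ x = 0 := by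
  obtain ⟨x, hx, h⟩ := exists_ker_of_skew hdim (S.w 2) (S.skew 2)
  have hv : ∀ y z t, wedgeForm (S.w 2) (S.w 2) x y z t = 0 := fun y z t => by
    simp [wedgeForm, h]
  have hne : S.e x ≠ 0 := fun h0 => hx (S.nondeg x h0 hv)
  have hne2 : ∃ x y z t, wedgeForm (S.w 2) (S.w 2) x y z t ≠ 0 := by
    by_contra! hcon
    have : Module.Finite ℝ L := Module.finite_of_finrank_eq_succ hdim
    have hinj : Function.Injective S.e := by
      rw [← LinearMap.ker_eq_bot, LinearMap.ker_eq_bot']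
      exact fun m hm => S.nondeg m hm (hcon m)
    have := LinearMap.finrank_le_finrank_of_injective hinj
    simp [hdim] at this
  refine ⟨(S.e x)⁻¹ • x, by simp [hne], fun i y => ?_⟩
  rw [map_smul, LinearMap.smul_apply, S.contract_eq_zero i x h hne2, smul_zero]

theorem eq_zero_of_ker (i : Fin 3) (x : L) (he : S.e x = 0) (h : ∀ y, S.w i x y = 0) : x = 0 := by
  refine S.nondeg x he fun y z t => ?_
  have h1 := S.wedge_eq i i x y z t
  rw [if_pos rfl] at h1
  rw [← h1]
  simp [wedgeForm, h]

/-- Every linear form that annihilates the Reeb vector is the contraction of `ω i` with a vector of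
the contact distribution. -/
theorem exists_dual (hdim : Module.finrank ℝ L = 5) {ξ : L} (he : S.e ξ = 1)
    (hξ : ∀ i x, S.w i ξ x = 0) (i : Fin 3) (α : L →ₗ[ℝ] ℝ) (hα : α ξ = 0) :
    ∃ x, S.e x = 0 ∧ ∀ y, S.w i x y = α y := by
  have : Module.Finite ℝ L := Module.finite_of_finrank_eq_succ hdim
  let Φ : L →ₗ[ℝ] Module.Dual ℝ L := S.w i + S.e.smulRight S.e
  have hΦ (x y : L) : Φ x y = S.w i x y + S.e x * S.e y := by simp [Φ]
  have hw (x : L) : S.w i x ξ = 0 := by rw [S.skew, hξ, neg_zero]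
  have hinj : Function.Injective Φ := by
    rw [← LinearMap.ker_eq_bot, LinearMap.ker_eq_bot']
    intro x hx
    have h0 : S.e x = 0 := by
      have := hΦ x ξ
      rw [hx, hw, he] at this
      simpa using this.symm
    refine S.eq_zero_of_ker i x h0 fun y => ?_
    have := hΦ x y
    rw [hx, h0] at this
    simpa using this.symm
  have hsurj : Function.Surjective Φ :=
    (LinearMap.injective_iff_surjective_of_finrank_eq_finrank
      (Subspace.dual_finrank_eq (K := ℝ) (V := L)).symm).mp hinj
  obtain ⟨x, hx⟩ := hsurj α
  have h0 : S.e x = 0 := by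
    have := hΦ x ξ
    rw [hx, hw, he, hα] at this
    simpa using this.symm
  refine ⟨x, h0, fun y => ?_⟩
  have := hΦ x y
  rw [hx, h0] at this
  simpa using this.symm

/-- The contraction of `v = ω i ∧ ω i` with the vector dual to `-α` under `ω i`. -/
theorem two_mul_apply (i : Fin 3) {α : L →ₗ[ℝ] ℝ} {a x : L} (ha : α a = 1)
    (hx : ∀ y, S.w i x y = - α y) (y z : L) :
    2 * S.w i y z = 2 * (α y * S.w i a z - α z * S.w i a y) -
      wedgeForm (S.w 2) (S.w 2) x a y z := by
  have h := S.wedge_eq i i x a y z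
  rw [if_pos rfl] at h
  rw [← h]
  simp only [wedgeForm, hx, ha]
  ring

theorem exists_wedgeForm_ne_zero {x : L} (hx : x ≠ 0) (he : S.e x = 0) :
    ∃ x y z t, wedgeForm (S.w 2) (S.w 2) x y z t ≠ 0 := by
  by_contra! hcon
  exact hx (S.nondeg x he (hcon x))

/-- The vectors dual to `-α` under the three forms are linearly independent: for a relation with
coefficients `c`, the form `Ω = ∑ cᵢ ωᵢ` is divisible by `α`, so that `0 = Ω ∧ Ω = |c|² v`. -/
theorem linearIndependent_frame {ξ : L} (he : S.e ξ = 1) {α : L →ₗ[ℝ] ℝ} (hα : α ξ = 0)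
    {a : L} (ha : α a = 1) (hea : S.e a = 0) {x : Fin 3 → L} (hex : ∀ i, S.e (x i) = 0)
    (hx : ∀ i y, S.w i (x i) y = - α y) :
    LinearIndependent ℝ ![a, x 0, x 1, x 2, ξ] := by
  rw [Fintype.linearIndependent_iff]
  intro c hc
  simp only [Fin.sum_univ_five, Matrix.cons_val] at hc
  have hax (i : Fin 3) : α (x i) = 0 := by
    have := hx i (x i)
    rw [S.self] at this
    linarith
  have hxne : x 0 ≠ 0 := by
    intro h0
    have := hx 0 a
    rw [h0, ha] at this
    simp at this
  obtain ⟨x₁, x₂, x₃, x₄, hv⟩ := S.exists_wedgeForm_ne_zero hxne (hex 0)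
  have c0 : c 0 = 0 := by
    have := congrArg α hc
    simpa [ha, hax, hα] using this
  have c4 : c 4 = 0 := by
    have := congrArg S.e hc
    simpa [hea, hex, he] using this
  have hΩ : ∀ y z, (c 1 • S.w 0 + c 2 • S.w 1 + c 3 • S.w 2) y z =
      α y * ((c 1 • S.w 0 + c 2 • S.w 1 + c 3 • S.w 2) a) z -
      α z * ((c 1 • S.w 0 + c 2 • S.w 1 + c 3 • S.w 2) a) y := by
    intro y z
    have hV : c 1 * wedgeForm (S.w 2) (S.w 2) (x 0) a y z +
        c 2 * wedgeForm (S.w 2) (S.w 2) (x 1) a y z +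
        c 3 * wedgeForm (S.w 2) (S.w 2) (x 2) a y z =
        wedgeForm (S.w 2) (S.w 2) (c 1 • x 0 + c 2 • x 1 + c 3 • x 2) a y z := by
      simp only [wedgeForm, map_add, map_smul, LinearMap.add_apply, LinearMap.smul_apply,
        smul_eq_mul]
      ring
    rw [c0, c4, zero_smul, zero_smul, zero_add, add_zero] at hc
    have hz : wedgeForm (S.w 2) (S.w 2) 0 a y z = 0 := by simp [wedgeForm]
    rw [hc, hz] at hV
    have h0 := S.two_mul_apply 0 ha (hx 0) y z
    have h1 := S.two_mul_apply 1 ha (hx 1) y z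
    have h2 := S.two_mul_apply 2 ha (hx 2) y z
    simp only [LinearMap.add_apply, LinearMap.smul_apply, smul_eq_mul]
    linear_combination c 1 / 2 * h0 + c 2 / 2 * h1 + c 3 / 2 * h2 - hV / 2
  have hsq : (c 1 ^ 2 + c 2 ^ 2 + c 3 ^ 2) * wedgeForm (S.w 2) (S.w 2) x₁ x₂ x₃ x₄ = 0 := by
    rw [← wedgeForm_self_of_decomposable hΩ x₁ x₂ x₃ x₄]
    have h00 := S.wedge_eq 0 0 x₁ x₂ x₃ x₄
    have h11 := S.wedge_eq 1 1 x₁ x₂ x₃ x₄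
    have h01 := S.wedge_eq 0 1 x₁ x₂ x₃ x₄
    have h02 := S.wedge_eq 0 2 x₁ x₂ x₃ x₄
    have h12 := S.wedge_eq 1 2 x₁ x₂ x₃ x₄
    simp only [Fin.isValue, Fin.reduceEq, if_true, if_false] at h00 h11 h01 h02 h12
    simp only [wedgeForm, LinearMap.add_apply, LinearMap.smul_apply, smul_eq_mul] at *
    linear_combination -c 1 ^ 2 * h00 - c 2 ^ 2 * h11 - 2 * c 1 * c 2 * h01 - 2 * c 1 * c 3 * h02
      - 2 * c 2 * c 3 * h12
  have hc0 := (mul_eq_zero.mp hsq).resolve_right hv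
  have c1 : c 1 = 0 := by nlinarith [sq_nonneg (c 1), sq_nonneg (c 2), sq_nonneg (c 3)]
  have c2 : c 2 = 0 := by nlinarith [sq_nonneg (c 1), sq_nonneg (c 2), sq_nonneg (c 3)]
  have c3 : c 3 = 0 := by nlinarith [sq_nonneg (c 1), sq_nonneg (c 2), sq_nonneg (c 3)]
  intro i
  fin_cases i <;> assumption

/-- A frame in which `η = e⁵`, `ω₁ = e¹² + e³⁴`, `ω₂ = e¹³ - e²⁴`, `ω₃ = e¹⁴ + e²³`; here `eⁱ` is
the covector dual to `X (i - 1)`. -/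
structure IsFrame (X : Fin 5 → L) : Prop where
  e_zero : S.e (X 0) = 0
  e_one : S.e (X 1) = 0
  e_two : S.e (X 2) = 0
  e_three : S.e (X 3) = 0
  e_four : S.e (X 4) = 1
  ker : ∀ i x, S.w i (X 4) x = 0
  w_zero_one : ∀ i, S.w i (X 0) (X 1) = if i = 0 then 1 else 0
  w_zero_two : ∀ i, S.w i (X 0) (X 2) = if i = 1 then 1 else 0
  w_zero_three : ∀ i, S.w i (X 0) (X 3) = if i = 2 then 1 else 0
  w_one_two : ∀ i, S.w i (X 1) (X 2) = if i = 2 then 1 else 0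
  w_one_three : ∀ i, S.w i (X 1) (X 3) = if i = 1 then -1 else 0
  w_two_three : ∀ i, S.w i (X 2) (X 3) = if i = 0 then 1 else 0

/-- A linear form that annihilates the Reeb vector is, up to scale, the first covector of a frame.
The frame consists of the vectors dual to the form, of a vector `b` that completes them, and of
the Reeb vector. -/
theorem exists_frame (hdim : Module.finrank ℝ L = 5) {ξ : L} (he : S.e ξ = 1)
    (hξ : ∀ i x, S.w i ξ x = 0) {α : L →ₗ[ℝ] ℝ} (hα : α ξ = 0) (hα0 : α ≠ 0) :
    ∃ X : Module.Basis (Fin 5) ℝ L, S.IsFrame X ∧ α (X 0) ≠ 0 ∧ α (X 1) = 0 ∧ α (X 2) = 0 ∧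
      α (X 3) = 0 ∧ α (X 4) = 0 := by
  have : Module.Finite ℝ L := Module.finite_of_finrank_eq_succ hdim
  have hdual (i : Fin 3) : ∃ x, S.e x = 0 ∧ ∀ y, S.w i x y = - α y :=
    S.exists_dual hdim he hξ i (-α) (by simp [hα])
  choose x hex hx using hdual
  obtain ⟨a, ha, hea⟩ : ∃ a, α a = 1 ∧ S.e a = 0 := by
    obtain ⟨y, hy⟩ : ∃ y, α y ≠ 0 := by
      by_contra! h
      exact hα0 (LinearMap.ext h)
    exact ⟨(α y)⁻¹ • (y - S.e y • ξ), by simp [hα, hy], by simp [he]⟩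
  have hax (i : Fin 3) : α (x i) = 0 := by
    have := hx i (x i)
    rw [S.self] at this
    linarith
  have hli := S.linearIndependent_frame he hα ha hea hex hx
  let B := basisOfLinearIndependentOfCardEqFinrank hli (by rw [hdim]; rfl)
  have hB : ∀ i, B i = ![a, x 0, x 1, x 2, ξ] i := fun i => by simp [B]
  have hw (i : Fin 3) (y : L) : S.w i y ξ = 0 := by rw [S.skew, hξ, neg_zero]
  -- The restrictions of the three forms to the kernel of `α` are governed by a single number.
  set r := S.w 0 (x 1) (x 2) with hr
  have h00 := S.wedge_eq 0 0 a (x 0) (x 1) (x 2)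
  have h11 := S.wedge_eq 1 1 a (x 0) (x 1) (x 2)
  have h01 := S.wedge_eq 0 1 a (x 0) (x 1) (x 2)
  have h02 := S.wedge_eq 0 2 a (x 0) (x 1) (x 2)
  have h12 := S.wedge_eq 1 2 a (x 0) (x 1) (x 2)
  have hxa (i : Fin 3) : S.w i a (x i) = 1 := by rw [S.skew, hx, ha, neg_neg]
  have hxl (i j : Fin 3) : S.w i (x i) (x j) = 0 := by rw [hx, hax, neg_zero]
  have hxr (i j : Fin 3) : S.w i (x j) (x i) = 0 := by rw [S.skew, hxl, neg_zero]
  simp only [Fin.isValue, Fin.reduceEq, if_true, if_false, wedgeForm, hxa, hxl, hxr, ← hr]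
    at h00 h11 h01 h02 h12
  have hr2 : S.w 2 (x 0) (x 1) = r := by linarith
  have hr1 : S.w 1 (x 0) (x 2) = -r := by linarith
  rw [hr2] at h02 h12
  rw [hr1] at h01 h12
  have hr0 : r ≠ 0 := by
    intro h0
    have hzero : S.w 0 (x 1 - S.w 0 a (x 1) • x 0) = 0 := by
      refine B.ext fun i => ?_
      rw [hB]
      fin_cases i <;> simp [hx, ha, hax, hα, hxr, S.self, hw, ← hr, h0]
      rw [S.skew]
      ring
    have hz := S.eq_zero_of_ker 0 (x 1 - S.w 0 a (x 1) • x 0) (by simp [hex]) fun y => by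
      rw [hzero, LinearMap.zero_apply]
    have := Fintype.linearIndependent_iff.mp hli ![0, - S.w 0 a (x 1), 1, 0, 0]
      (by simpa [Fin.sum_univ_five, sub_eq_neg_add] using hz) 2
    simp at this
  have e01 : S.w 1 a (x 0) = - S.w 0 a (x 1) := by
    apply mul_right_cancel₀ hr0; linarith
  have e02 : S.w 2 a (x 0) = - S.w 0 a (x 2) := by
    apply mul_right_cancel₀ hr0; linarith
  have e12 : S.w 2 a (x 1) = - S.w 1 a (x 2) := by
    apply mul_right_cancel₀ hr0; linarith
  -- The correction of `a` by `x 0`, `x 1`, `x 2` makes the remaining values vanish.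
  set b := a + (S.w 1 a (x 2) / r) • x 0 - (S.w 0 a (x 2) / r) • x 1 + (S.w 0 a (x 1) / r) • x 2
    with hb
  have hb0 (i j : Fin 3) : S.w i b (x j) = if i = j then 1 else 0 := by
    have s21 : S.w 0 (x 2) (x 1) = - r := by rw [S.skew]
    have s20 : S.w 1 (x 2) (x 0) = r := by rw [S.skew, hr1, neg_neg]
    have s10 : S.w 2 (x 1) (x 0) = - r := by rw [S.skew, hr2]
    fin_cases i <;> fin_cases j <;>
      simp [hb, hxa, hxl, hxr, e01, e02, e12, s21, s20, s10, ← hr, hr2, hr1, S.self, hr0]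
  have hrpos : 0 < r := by
    refine lt_of_le_of_ne ?_ hr0.symm
    have := S.nonneg (x 0) (- x 2) (LinearMap.congr_fun (f := S.w 2 (x 0)) (g := S.w 0 (- x 2)) ?_)
    · rw [map_neg, hr1] at this
      linarith
    · have hlib := S.linearIndependent_frame he hα (a := b) (by simp [hb, ha, hax])
        (by simp [hb, hea, hex]) hex hx
      let B' := basisOfLinearIndependentOfCardEqFinrank hlib (by rw [hdim]; rfl)
      have hB' : ∀ i, B' i = ![b, x 0, x 1, x 2, ξ] i := fun i => by simp [B']
      refine B'.ext fun i => ?_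
      rw [hB']
      have hbs (i j : Fin 3) : S.w i (x j) b = - if i = j then 1 else 0 := by rw [S.skew, hb0]
      have s21 : S.w 0 (x 2) (x 1) = - r := by rw [S.skew]
      fin_cases i <;> simp [hbs, hxr, S.self, hw, s21, hr2]
  -- Scaling the form by `t` multiplies `r` by `t²`.
  obtain ⟨t, ht, htr⟩ : ∃ t : ℝ, t ≠ 0 ∧ t * t * r = 1 :=
    ⟨(√r)⁻¹, by positivity, by
      rw [← mul_inv, Real.mul_self_sqrt hrpos.le, inv_mul_cancel₀ hr0]⟩
  have hli' := S.linearIndependent_frame he (α := t • α) (by simp [hα]) (a := t⁻¹ • b)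
    (x := fun i => t • x i) (by simp [hb, ha, hax, ht]) (by simp [hb, hea, hex])
    (by simp [hex]) (by simp [hx])
  let B' := basisOfLinearIndependentOfCardEqFinrank hli' (by rw [hdim]; rfl)
  have hB' : ∀ i, B' i = ![t⁻¹ • b, t • x 0, t • x 1, t • x 2, ξ] i := fun i => by simp [B']
  refine ⟨B', ⟨?_, ?_, ?_, ?_, ?_, ?_, ?_, ?_, ?_, ?_, ?_, ?_⟩, ?_, ?_, ?_, ?_, ?_⟩
  case refine_6 => simpa [hB'] using hξ
  case refine_13 => simp [hB', hb, ha, hax, ht]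
  all_goals simp only [hB', Matrix.cons_val, map_smul, LinearMap.smul_apply, smul_eq_mul, hex, hax,
    hα, he, mul_zero, hb0]
  · simp [hb, hea, hex]
  · intro i; fin_cases i <;> simp [ht]
  · intro i; fin_cases i <;> simp [ht]
  · intro i; fin_cases i <;> simp [ht]
  · intro i; fin_cases i <;> simp [hxl, hxr, hr2]; linarith
  · intro i; fin_cases i <;> simp [hxl, hxr, hr1]; linarith
  · intro i; fin_cases i <;> simp [hxl, hxr, ← hr]; linarith

end BilinearSU2

/-! ### A closed form that annihilates the Reeb vector -/

/-- An ideal `D` contained in `⁅L, L⁆` carries no linear form `e` for which `(x, y) ↦ e ⁅x, y⁆` is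
nondegenerate on `D`: for the vector `u` with `e ⁅u, y⁆ = e y`, the endomorphism `ad u` of `D` and
its adjoint add up to the identity, so that its trace is `dim D / 2`, but elements of `⁅L, L⁆` act
with trace zero. -/
theorem eq_bot_of_nondegenerate_coboundary {L : Type*} [LieRing L] [LieAlgebra ℝ L]
    [Module.Finite ℝ L] (D : LieIdeal ℝ L) (hD : D ≤ LieAlgebra.derivedSeries ℝ L 1)
    (e : L →ₗ[ℝ] ℝ) (h : ∀ x ∈ D, (∀ y ∈ D, e ⁅x, y⁆ = 0) → x = 0) : D = ⊥ := by
  let B : D →ₗ[ℝ] Module.Dual ℝ D :=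
    LinearMap.mk₂ ℝ (fun x y => e ⁅(x : L), (y : L)⁆) (by simp) (by simp) (by simp) (by simp)
  have hB (x y : D) : B x y = e ⁅(x : L), (y : L)⁆ := rfl
  have hinj : Function.Injective B := by
    rw [← LinearMap.ker_eq_bot, LinearMap.ker_eq_bot']
    intro x hx
    refine Subtype.ext (h x x.2 fun y hy => ?_)
    rw [← hB x ⟨y, hy⟩, hx, LinearMap.zero_apply]
  let E : D ≃ₗ[ℝ] Module.Dual ℝ D :=
    LinearEquiv.ofInjectiveOfFinrankEq B hinj (Subspace.dual_finrank_eq (K := ℝ) (V := D)).symm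
  obtain ⟨u, hu⟩ := E.surjective (e ∘ₗ D.toSubmodule.subtype)
  have hu' (y : D) : e ⁅(u : L), (y : L)⁆ = e y := LinearMap.congr_fun hu y
  set M := LieModule.toEnd ℝ L D u with hM
  have hM0 : LinearMap.trace ℝ D M = 0 :=
    LieModule.trace_toEnd_eq_zero_of_mem_lcs ℝ L D le_rfl (hD u.2)
  have hconj : E.conj (1 - M) = M.dualMap := by
    refine LinearMap.ext fun f => ?_
    obtain ⟨x, rfl⟩ := E.surjective f
    refine LinearMap.ext fun y => ?_
    have hEB (z : D) : E z = B z := rfl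
    rw [LinearEquiv.conj_apply_apply, LinearEquiv.symm_apply_apply, LinearMap.dualMap_apply, hEB,
      hEB, hB, hB]
    have h1 : e ⁅(u : L), ⁅(x : L), (y : L)⁆⁆ = e ⁅(x : L), (y : L)⁆ := hu' ⁅x, y⁆
    have h2 : (((1 - M) x : D) : L) = x - ⁅(u : L), (x : L)⁆ := rfl
    have h3 : ((M y : D) : L) = ⁅(u : L), (y : L)⁆ := rfl
    rw [h2, h3, sub_lie, map_sub, ← h1, leibniz_lie, map_add, add_sub_cancel_left]
  have ht := LinearMap.trace_conj' (1 - M) E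
  have ht2 : LinearMap.trace ℝ _ M.dualMap = LinearMap.trace ℝ _ M := LinearMap.trace_transpose' M
  rw [hconj, ht2, map_sub, hM0, LinearMap.trace_one, sub_zero] at ht
  have : Module.finrank ℝ D = 0 := by exact_mod_cast ht.symm
  have := Module.finrank_zero_iff.mp this
  refine (LieSubmodule.eq_bot_iff D).mpr fun x hx => ?_
  exact congrArg Subtype.val (Subsingleton.elim (⟨x, hx⟩ : D) 0)

/-- On a solvable Lie algebra of dimension `5`, the derived algebra and the Reeb vector `ξ` do not
span everything: if they did, `[L, L]` would be a complement of `ξ`, on which `dη` is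
nondegenerate. -/
theorem exists_closed_form {L : Type*} [LieRing L] [LieAlgebra ℝ L]
    (hdim : Module.finrank ℝ L = 5) [LieAlgebra.IsSolvable L] (S : BilinearSU2 L)
    (hd : ∀ x y : L, S.e ⁅x, y⁆ = 2 * S.w 2 x y) {ξ : L} (he : S.e ξ = 1)
    (hξ : ∀ i x, S.w i ξ x = 0) :
    ∃ α : L →ₗ[ℝ] ℝ, α ≠ 0 ∧ α ξ = 0 ∧ ∀ x y : L, α ⁅x, y⁆ = 0 := by
  have : Module.Finite ℝ L := Module.finite_of_finrank_eq_succ hdim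
  have : Nontrivial L := Module.nontrivial_of_finrank_eq_succ hdim
  set D := LieAlgebra.derivedSeries ℝ L 1 with hDdef
  have hbr (x y : L) : ⁅x, y⁆ ∈ D := LieSubmodule.lie_mem_lie trivial trivial
  have hD : D < ⊤ := LieAlgebra.derivedSeries_lt_top_of_solvable ℝ L
  rcases lt_or_eq_of_le (le_top : D.toSubmodule ⊔ ℝ ∙ ξ ≤ ⊤) with hlt | heq
  · obtain ⟨f, hf, hker⟩ := Submodule.exists_le_ker_of_lt_top _ hlt
    refine ⟨f, hf, ?_, fun x y => ?_⟩
    · exact hker (Submodule.mem_sup_right (Submodule.mem_span_singleton_self ξ))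
    · exact hker (Submodule.mem_sup_left (hbr x y))
  exfalso
  have hdec (y : L) : ∃ z ∈ D, ∃ c : ℝ, y = z + c • ξ := by
    obtain ⟨z, hz, t, ht, rfl⟩ := Submodule.mem_sup.mp (heq ▸ Submodule.mem_top : y ∈ _)
    obtain ⟨c, rfl⟩ := Submodule.mem_span_singleton.mp ht
    exact ⟨z, hz, c, rfl⟩
  have hξD : ξ ∉ D := by
    intro hmem
    apply hD.ne
    rw [eq_top_iff]
    intro y _
    obtain ⟨z, hz, c, rfl⟩ := hdec y
    exact add_mem hz (D.smul_mem c hmem)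
  have hbot := eq_bot_of_nondegenerate_coboundary D le_rfl S.e fun x hx hxy => by
    have hw (y : L) : S.w 2 x y = 0 := by
      obtain ⟨z, hz, c, rfl⟩ := hdec y
      have h1 := hxy z hz
      have h2 : S.w 2 x ξ = 0 := by rw [S.skew, hξ, neg_zero]
      rw [hd] at h1
      rw [map_add, map_smul, h2]
      simpa using h1
    have h0 := S.eq_zero_of_ker 2 (x - S.e x • ξ) (by simp [he]) fun y => by simp [hw, hξ]
    by_cases hex : S.e x = 0
    · simpa [hex] using h0
    · refine absurd ?_ hξD
      have : ξ = (S.e x)⁻¹ • x := by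
        rw [sub_eq_zero.mp h0]
        simp [smul_smul, he, hex]
      rw [this]
      exact D.smul_mem _ hx
  rw [hbot] at heq
  have h1 := finrank_span_singleton (K := ℝ) (v := ξ) (fun h0 => hξD (h0 ▸ D.zero_mem))
  simp at heq
  rw [heq, finrank_top, hdim] at h1
  norm_num at h1

/-! ### Brackets in an adapted frame -/

/-- The brackets of a frame adapted to a hypo-contact structure whose first covector is closed.
The symmetric matrix with rows `(a, b, p)`, `(b, c, q)`, `(p, q, g - c)` is that of `ad (X 0)` on
the span of `X 1`, `X 2`, `X 3`, modulo the Reeb vector `X 4`; the coefficients `l, m, n, u, v, w`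
describe the action of the Reeb vector. -/
structure IsAdapted {L : Type*} [LieRing L] [LieAlgebra ℝ L] (X : Fin 5 → L)
    (a b c g p q l m n u v w : ℝ) : Prop where
  b01 : ⁅X 0, X 1⁆ = a • X 1 + b • X 2 + p • X 3
  b02 : ⁅X 0, X 2⁆ = b • X 1 + c • X 2 + q • X 3
  b03 : ⁅X 0, X 3⁆ = p • X 1 + q • X 2 + (g - c) • X 3 + (2 : ℝ) • X 4
  b04 : ⁅X 0, X 4⁆ = l • X 1 + m • X 2 + n • X 3
  b12 : ⁅X 1, X 2⁆ = (-p) • X 1 + (-q) • X 2 + (a + c) • X 3 + (2 : ℝ) • X 4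
  b13 : ⁅X 1, X 3⁆ = b • X 1 + (c - a - g) • X 2 + q • X 3
  b14 : ⁅X 1, X 4⁆ = u • X 1 + v • X 2 + m • X 3
  b23 : ⁅X 2, X 3⁆ = g • X 1 + (-b) • X 2 + (-p) • X 3
  b24 : ⁅X 2, X 4⁆ = w • X 1 + (-u) • X 2 + (-l) • X 3
  b34 : ⁅X 3, X 4⁆ = 0

theorem eta_lie {L : Type*} [LieRing L] [LieAlgebra ℝ L]
    (H : HypoContactStructure L) (x y : L) : H.η ![⁅x, y⁆] = 2 * H.ω 2 ![x, y] := by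
  have h := H.d_eta ![x, y]
  rw [extD_one_apply] at h
  simp only [Matrix.cons_val] at h
  linarith

/-- On the contact distribution, `d(η ∧ ω) = 0` says that `dω = 0`. -/
theorem cyclic_of_extD_wedge {L : Type*} [LieRing L] [LieAlgebra ℝ L] (H : HypoContactStructure L)
    (b : L [⋀^Fin 2]→ₗ[ℝ] ℝ)
    (hb : ∀ v : Fin 4 → L, extD (n := 2) (wedge (m := 1) (n := 2) H.η b) v = 0) {ξ : L}
    (hξ : H.η ![ξ] = 1) (hω : ∀ x, H.ω 2 ![ξ, x] = 0) (hbξ : ∀ x, b ![ξ, x] = 0) {x y z : L}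
    (hx : H.η ![x] = 0) (hy : H.η ![y] = 0) (hz : H.η ![z] = 0) :
    b ![⁅x, y⁆, z] - b ![⁅x, z⁆, y] + b ![⁅y, z⁆, x] = 0 := by
  have h := hb ![ξ, x, y, z]
  rw [extD_three_apply] at h
  simp only [wedge_one_two_apply, Matrix.cons_val, eta_lie, hξ, hω, hbξ, hx, hy, hz] at h
  linarith

/-- The hypo-contact equations say that the three forms are closed on the contact distribution and
that the Reeb vector preserves `ω₃`. With the closed first covector these are linear equations for
the structure constants, whose solutions have the form `IsAdapted`. -/
theorem exists_adapted {L : Type*} [LieRing L] [LieAlgebra ℝ L]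
    (hdim : Module.finrank ℝ L = 5) [LieAlgebra.IsSolvable L] (H : HypoContactStructure L) :
    ∃ (X : Module.Basis (Fin 5) ℝ L) (a b c g p q l m n u v w : ℝ),
      IsAdapted X a b c g p q l m n u v w := by
  set S := H.toSU2Structure.toBilinearSU2 hdim with hS
  have hd (x y : L) : S.e ⁅x, y⁆ = 2 * S.w 2 x y := eta_lie H x y
  obtain ⟨ξ, hξ, hker⟩ := S.exists_reeb hdim
  obtain ⟨α, hα, hαξ, hαd⟩ := exists_closed_form hdim S hd hξ hker
  obtain ⟨X, hX, h0, h1, h2, h3, h4⟩ := S.exists_frame hdim hξ hker hαξ hα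
  have hjac (x y z : L) : S.w 2 ⁅x, y⁆ z - S.w 2 ⁅x, z⁆ y + S.w 2 ⁅y, z⁆ x = 0 := by
    have h : ⁅⁅x, y⁆, z⁆ - ⁅⁅x, z⁆, y⁆ + ⁅⁅y, z⁆, x⁆ = 0 := by
      rw [lie_lie, ← lie_skew y ⁅x, z⁆, ← lie_skew x ⁅y, z⁆]
      abel
    have h2 := congrArg S.e h
    rw [map_add, map_sub, hd, hd, hd, map_zero] at h2
    linarith
  have hcyc (i : Fin 3) {x y z : L} (hx : S.e x = 0) (hy : S.e y = 0) (hz : S.e z = 0) :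
      S.w i ⁅x, y⁆ z - S.w i ⁅x, z⁆ y + S.w i ⁅y, z⁆ x = 0 := by
    have h01 : i = 0 ∨ i = 1 ∨ i = 2 := by fin_cases i <;> simp
    rcases h01 with rfl | rfl | rfl
    · exact cyclic_of_extD_wedge H (H.ω 0) H.d_eta_wedge_one hX.e_four (hX.ker 2) (hX.ker 0)
        hx hy hz
    · exact cyclic_of_extD_wedge H (H.ω 1) H.d_eta_wedge_two hX.e_four (hX.ker 2) (hX.ker 1)
        hx hy hz
    · exact hjac x y z
  have hcyc' (x y : L) : S.w 2 ⁅x, X 4⁆ y + S.w 2 x ⁅y, X 4⁆ = 0 := by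
    have h := hjac x y (X 4)
    rw [S.skew 2 ⁅x, y⁆, hX.ker, S.skew 2 ⁅y, X 4⁆] at h
    linarith
  have hbr (i j : Fin 5) : ∃ c₁ c₂ c₃ : ℝ, ⁅X i, X j⁆ =
      c₁ • X 1 + c₂ • X 2 + c₃ • X 3 + (2 * S.w 2 (X i) (X j)) • X 4 := by
    have hs := X.sum_repr ⁅X i, X j⁆
    rw [Fin.sum_univ_five] at hs
    have hs0 : X.repr ⁅X i, X j⁆ 0 = 0 := by
      have := congrArg α hs
      rw [hαd] at this
      simpa [h1, h2, h3, h4, h0] using this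
    have hs4 : X.repr ⁅X i, X j⁆ 4 = 2 * S.w 2 (X i) (X j) := by
      have := congrArg S.e hs
      rw [hd] at this
      simpa [hX.e_zero, hX.e_one, hX.e_two, hX.e_three, hX.e_four] using this
    refine ⟨X.repr ⁅X i, X j⁆ 1, X.repr ⁅X i, X j⁆ 2, X.repr ⁅X i, X j⁆ 3, ?_⟩
    rw [hs0, zero_smul, zero_add] at hs
    rw [← hs4, hs]
  choose f₁ f₂ f₃ hf using hbr
  have sk (i : Fin 3) (j k : Fin 5) := S.skew i (X j) (X k)
  have hw4 (i : Fin 3) (x : L) : S.w i x (X 4) = 0 := by rw [S.skew, hX.ker, neg_zero]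
  have E (i : Fin 3) (j k l : Fin 5) : S.w i ⁅X j, X k⁆ (X l) = f₁ j k * S.w i (X 1) (X l) +
      f₂ j k * S.w i (X 2) (X l) + f₃ j k * S.w i (X 3) (X l) := by
    rw [hf]
    simp [hX.ker]
  have C (i : Fin 3) (j k l : Fin 5) (hj : S.e (X j) = 0) (hk : S.e (X k) = 0)
      (hl : S.e (X l) = 0) := hcyc i hj hk hl
  simp only [E] at C
  have C' (j k : Fin 5) := hcyc' (X j) (X k)
  simp only [S.skew 2 (X _) ⁅X _, X _⁆, E] at C'
  have e0 := hX.e_zero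
  have e1 := hX.e_one
  have e2 := hX.e_two
  have e3 := hX.e_three
  have w10 (i : Fin 3) := sk i 1 0
  have w20 (i : Fin 3) := sk i 2 0
  have w30 (i : Fin 3) := sk i 3 0
  have w21 (i : Fin 3) := sk i 2 1
  have w31 (i : Fin 3) := sk i 3 1
  have w32 (i : Fin 3) := sk i 3 2
  simp only [hX.w_zero_one, hX.w_zero_two, hX.w_zero_three, hX.w_one_two, hX.w_one_three,
    hX.w_two_three] at w10 w20 w30 w21 w31 w32
  have A (i : Fin 3) := And.intro (C i 0 1 2 e0 e1 e2) <| And.intro (C i 0 1 3 e0 e1 e3) <|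
    And.intro (C i 0 2 3 e0 e2 e3) (C i 1 2 3 e1 e2 e3)
  simp only [hX.w_one_two, hX.w_one_three, hX.w_two_three, w10, w20, w30, w21, w31, w32,
    S.self] at A
  have A0 := A 0
  have A1 := A 1
  have A2 := A 2
  have B := And.intro (C' 0 1) <| And.intro (C' 0 2) <| And.intro (C' 0 3) <|
    And.intro (C' 1 2) <| And.intro (C' 1 3) (C' 2 3)
  simp only [hX.w_one_two, hX.w_one_three, hX.w_two_three, w10, w20, w30, w21, w31, w32,
    S.self] at B
  simp at A0 A1 A2 B
  obtain ⟨p1, p2, p3, p4⟩ := A0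
  obtain ⟨q1, q2, q3, q4⟩ := A1
  obtain ⟨r1, r2, r3, r4⟩ := A2
  obtain ⟨s1, s2, s3, s4, s5, s6⟩ := B
  refine ⟨X, f₁ 0 1, f₂ 0 1, f₂ 0 2, f₁ 2 3, f₃ 0 1, f₃ 0 2, f₁ 0 4, f₂ 0 4, f₃ 0 4, f₁ 1 4,
    f₂ 1 4, f₁ 2 4, ?_⟩
  have g1 : f₁ 0 2 = f₂ 0 1 := by linarith
  have g2 : f₁ 0 3 = f₃ 0 1 := by linarith
  have g3 : f₂ 0 3 = f₃ 0 2 := by linarith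
  have g4 : f₃ 0 3 = f₁ 2 3 - f₂ 0 2 := by linarith
  have g5 : f₁ 1 2 = -f₃ 0 1 := by linarith
  have g6 : f₂ 1 2 = -f₃ 0 2 := by linarith
  have g7 : f₃ 1 2 = f₁ 0 1 + f₂ 0 2 := by linarith
  have g8 : f₁ 1 3 = f₂ 0 1 := by linarith
  have g9 : f₂ 1 3 = f₂ 0 2 - f₁ 0 1 - f₁ 2 3 := by linarith
  have g10 : f₃ 1 3 = f₃ 0 2 := by linarith
  have g11 : f₂ 2 3 = -f₂ 0 1 := by linarith
  have g12 : f₃ 2 3 = -f₃ 0 1 := by linarith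
  have g13 : f₃ 1 4 = f₂ 0 4 := by linarith
  have g14 : f₃ 2 4 = -f₁ 0 4 := by linarith
  have g15 : f₂ 2 4 = -f₁ 1 4 := by linarith
  constructor <;>
    simp only [hf, g1, g2, g3, g4, g5, g6, g7, g8, g9, g10, g11, g12, g13, g14, g15, s3, s5, s6,
      hw4, hX.w_zero_one, hX.w_zero_two, hX.w_zero_three, hX.w_one_two, hX.w_one_three,
      hX.w_two_three, Fin.isValue, Fin.reduceEq, if_true, if_false] <;>
    module

/-! ### Isomorphisms with the algebras given by bracket tables -/

/-- `L` has a basis whose brackets are given by the table `T`. -/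
def HasBrackets (L : Type*) [LieRing L] [LieAlgebra ℝ L] (T : Fin 5 → Fin 5 → Fin 5 → ℝ) : Prop :=
  ∃ Y : Module.Basis (Fin 5) ℝ L, ∀ i j, i < j → ⁅Y i, Y j⁆ = ∑ k, T i j k • Y k

theorem tableBracket_stdVec (T : Fin 5 → Fin 5 → Fin 5 → ℝ) {i j : Fin 5} (hij : i < j) :
    tableBracket T (stdVec i) (stdVec j) = T i j := by
  simp only [tableBracket, stdVec]
  rw [Finset.sum_eq_single i, Finset.sum_eq_single j]
  · simp [hij, hij.ne, hij.ne']
  · intro k _ hk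
    split_ifs
    · simp [Pi.single_apply, hk, hij.ne]
    · rfl
  · simp
  · intro k _ hk
    refine Finset.sum_eq_zero fun k' _ => ?_
    split_ifs with h
    · by_cases h' : k' = i
      · subst h'
        simp [Pi.single_apply, hk, (h.trans hij).ne]
      · simp [Pi.single_apply, hk, h']
    · rfl
  · simp

theorem sum_smul_stdVec (x : Fin 5 → ℝ) : ∑ k, x k • stdVec k = x := by
  funext i
  simp [stdVec, Finset.sum_apply, Pi.single_apply]

/-- The standard basis of the Lie algebra of a table. -/
noncomputable def BracketTable.basis (B : BracketTable) : Module.Basis (Fin 5) ℝ B.Algebra :=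
  (Pi.basisFun ℝ (Fin 5) : Module.Basis (Fin 5) ℝ (Fin 5 → ℝ))

theorem BracketTable.basis_apply (B : BracketTable) (i : Fin 5) : B.basis i = stdVec i :=
  Pi.basisFun_apply ℝ (Fin 5) i

theorem BracketTable.lie_basis (B : BracketTable) {i j : Fin 5} (hij : i < j) :
    ⁅B.basis i, B.basis j⁆ = ∑ k, B.T i j k • B.basis k := by
  rw [B.basis_apply, B.basis_apply]
  simp only [B.basis_apply]
  exact (tableBracket_stdVec B.T hij).trans (sum_smul_stdVec (B.T i j)).symm

theorem nonempty_lieEquiv_iff {L : Type*} [LieRing L] [LieAlgebra ℝ L] (B : BracketTable) :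
    Nonempty (L ≃ₗ⁅ℝ⁆ B.Algebra) ↔ HasBrackets L B.T := by
  constructor
  · rintro ⟨e⟩
    refine ⟨B.basis.map e.symm.toLinearEquiv, fun i j hij => ?_⟩
    have h := congrArg e.symm (B.lie_basis hij)
    rw [LieEquiv.map_lie] at h
    simp only [Module.Basis.map_apply]
    refine h.trans ?_
    rw [← LieEquiv.coe_toLinearEquiv, map_sum]
    simp
  · rintro ⟨Y, hY⟩
    let f : L ≃ₗ[ℝ] B.Algebra := Y.equiv B.basis (Equiv.refl _)
    have hf (i : Fin 5) : f (Y i) = B.basis i := by simp [f]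
    have hlt (i j : Fin 5) (hij : i < j) : f ⁅Y i, Y j⁆ = ⁅f (Y i), f (Y j)⁆ := by
      rw [hY i j hij, hf, hf, B.lie_basis hij, map_sum]
      simp [hf]
    have key : LinearMap.mk₂ ℝ (fun x y : L => f ⁅x, y⁆) (by simp) (by simp) (by simp) (by simp) =
        LinearMap.mk₂ ℝ (fun x y : L => ⁅f x, f y⁆) (by simp) (by simp) (by simp) (by simp) := by
      refine Y.ext fun i => Y.ext fun j => ?_
      change f ⁅Y i, Y j⁆ = ⁅f (Y i), f (Y j)⁆
      rcases lt_trichotomy i j with h | rfl | h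
      · exact hlt i j h
      · simp
      · rw [← lie_skew, map_neg, hlt j i h, lie_skew]
    exact ⟨{ f with map_lie' := fun {x y} => LinearMap.congr_fun₂ key x y }⟩

/-- Five vectors whose linear combinations give a basis form a basis. -/
theorem exists_basis_of_combination {L : Type*} [AddCommGroup L] [Module ℝ L]
    (X : Module.Basis (Fin 5) ℝ L) (Z : Fin 5 → L) (M : Fin 5 → Fin 5 → ℝ)
    (h : ∀ i, X i = ∑ j, M i j • Z j) : ∃ B : Module.Basis (Fin 5) ℝ L, ∀ i, B i = Z i := by
  have hspan : ⊤ ≤ Submodule.span ℝ (Set.range Z) := by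
    rw [← X.span_eq, Submodule.span_le]
    rintro _ ⟨i, rfl⟩
    rw [h i]
    exact Submodule.sum_mem _ fun j _ =>
      Submodule.smul_mem _ _ (Submodule.subset_span (Set.mem_range_self j))
  have hcard : Fintype.card (Fin 5) = Module.finrank ℝ L := (Module.finrank_eq_card_basis X).symm
  exact ⟨basisOfTopLeSpanOfCardEqFinrank Z hspan hcard, fun i => by simp⟩

/-! ### Normal forms of adapted frames -/

namespace IsAdapted

variable {L : Type*} [LieRing L] [LieAlgebra ℝ L] {X : Module.Basis (Fin 5) ℝ L}
  {a b c g p q l m n u v w : ℝ}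

theorem jacobi_zero_one_two (h : IsAdapted X a b c g p q l m n u v w) :
    2 * l = -a * p + 2 * b * q - p * g - 2 * p * c ∧
    2 * m = -3 * a * q + 2 * b * p - g * q ∧
    2 * n = -a * g + 3 * a * c + a ^ 2 + 2 * p ^ 2 - g * c + 2 * c ^ 2 + 2 * q ^ 2 := by
  have hj := lie_jacobi (X 0) (X 1) (X 2)
  rw [← lie_skew (X 2) (X 0), h.b01, h.b02, h.b12] at hj
  simp only [lie_add, lie_smul, lie_neg, lie_self, ← lie_skew (X 2) (X 1), h.b01, h.b02, h.b03,
    h.b04, h.b12, h.b13, h.b23] at hj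
  have h1 := congrArg (X.coord 1) hj
  have h2 := congrArg (X.coord 2) hj
  have h3 := congrArg (X.coord 3) hj
  simp at h1 h2 h3
  exact ⟨by linear_combination h1, by linear_combination h2, by linear_combination h3⟩

theorem jacobi_zero_one_three (h : IsAdapted X a b c g p q l m n u v w) :
    2 * u = -a * b - 3 * b * g + 2 * b * c + 2 * p * q ∧
    2 * v = 2 * a * g - 3 * a * c + a ^ 2 + 2 * b ^ 2 - 3 * g * c + g ^ 2 + 2 * c ^ 2 + 2 * q ^ 2
      := by
  have hj := lie_jacobi (X 0) (X 1) (X 3)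
  rw [← lie_skew (X 3) (X 0), h.b01, h.b03, h.b13] at hj
  simp only [lie_add, lie_smul, lie_neg, lie_self, ← lie_skew (X 3) (X 1), ← lie_skew (X 3) (X 2),
    h.b01, h.b02, h.b03, h.b12, h.b13, h.b14, h.b23] at hj
  have h1 := congrArg (X.coord 1) hj
  have h2 := congrArg (X.coord 2) hj
  simp at h1 h2
  exact ⟨by linear_combination -h1, by linear_combination -h2⟩

theorem jacobi_zero_two_three (h : IsAdapted X a b c g p q l m n u v w) :
    2 * w = a * g - 2 * b ^ 2 - 2 * p ^ 2 - g ^ 2 := by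
  have hj := lie_jacobi (X 0) (X 2) (X 3)
  rw [← lie_skew (X 3) (X 0), h.b02, h.b03, h.b23] at hj
  simp only [lie_add, lie_smul, lie_neg, lie_self, ← lie_skew (X 2) (X 1), ← lie_skew (X 3) (X 1),
    ← lie_skew (X 3) (X 2), h.b01, h.b02, h.b03, h.b12, h.b13, h.b23, h.b24] at hj
  have h1 := congrArg (X.coord 1) hj
  simp at h1
  linear_combination -h1

theorem jacobi_zero_one_four (h : IsAdapted X a b c g p q l m n u v w) :
    a * v - a * n - 2 * b * u - g * n - c * v + c * n - 2 * q * m = 0 := by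
  have hj := lie_jacobi (X 0) (X 1) (X 4)
  rw [← lie_skew (X 4) (X 0), h.b01, h.b04, h.b14] at hj
  simp only [lie_add, lie_smul, lie_neg, lie_self, ← lie_skew (X 4) (X 1), ← lie_skew (X 4) (X 2),
    ← lie_skew (X 4) (X 3), h.b01, h.b02, h.b03, h.b12, h.b13, h.b14, h.b24, h.b34] at hj
  have h2 := congrArg (X.coord 2) hj
  simp at h2
  linear_combination -h2

theorem jacobi_zero_two_four (h : IsAdapted X a b c g p q l m n u v w) :
    -a * w + 2 * b * u + 2 * p * l + g * n + w * c = 0 ∧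
    -a * l + b * m - p * w - p * n + l * g - 3 * l * c + u * q = 0 := by
  have hj := lie_jacobi (X 0) (X 2) (X 4)
  rw [← lie_skew (X 4) (X 0), h.b02, h.b04, h.b24] at hj
  simp only [lie_add, lie_smul, lie_neg, lie_self, ← lie_skew (X 2) (X 1), ← lie_skew (X 4) (X 1),
    ← lie_skew (X 4) (X 2), ← lie_skew (X 4) (X 3), h.b01, h.b02, h.b03, h.b12, h.b14, h.b23,
    h.b24, h.b34] at hj
  have h1 := congrArg (X.coord 1) hj
  have h3 := congrArg (X.coord 3) hj
  simp at h1 h3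
  exact ⟨by linear_combination -h1, by linear_combination -h3⟩

theorem jacobi_zero_three_four (h : IsAdapted X a b c g p q l m n u v w) :
    a * l + b * m + p * v + l * g - l * c - u * q = 0 ∧
    2 * p * m - 2 * l * q = 0 := by
  have hj := lie_jacobi (X 0) (X 3) (X 4)
  rw [← lie_skew (X 4) (X 0), h.b03, h.b04, h.b34] at hj
  simp only [lie_add, lie_smul, lie_neg, lie_self, lie_zero, ← lie_skew (X 3) (X 1),
    ← lie_skew (X 3) (X 2), ← lie_skew (X 4) (X 1), ← lie_skew (X 4) (X 2), ← lie_skew (X 4) (X 3),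
    h.b13, h.b14,
    h.b23, h.b24, h.b34] at hj
  have h2 := congrArg (X.coord 2) hj
  have h3 := congrArg (X.coord 3) hj
  simp at h2 h3
  exact ⟨by linear_combination -h2, by linear_combination -h3⟩

theorem jacobi_one_three_four (h : IsAdapted X a b c g p q l m n u v w) :
    -a * w - g * w - g * v + w * c = 0 := by
  have hj := lie_jacobi (X 1) (X 3) (X 4)
  rw [← lie_skew (X 4) (X 1), h.b13, h.b14, h.b34] at hj
  simp only [lie_add, lie_smul, lie_neg, lie_self, lie_zero, ← lie_skew (X 3) (X 1),
    ← lie_skew (X 3) (X 2), ← lie_skew (X 4) (X 1), ← lie_skew (X 4) (X 2), ← lie_skew (X 4) (X 3),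
    h.b13, h.b14,
    h.b23, h.b24, h.b34] at hj
  have h1 := congrArg (X.coord 1) hj
  simp at h1
  linear_combination -h1

/-- Rotating the first two forms of the `SU(2)`-structure rotates `X 1` and `X 2`; the closed
covector and the Reeb vector stay the same. -/
theorem rotate (h : IsAdapted X a b c g p q l m n u v w) {x y : ℝ} (hxy : x ^ 2 + y ^ 2 = 1) :
    ∃ (X' : Module.Basis (Fin 5) ℝ L), IsAdapted X'
      (x ^ 2 * a + 2 * x * y * b + y ^ 2 * c) ((x ^ 2 - y ^ 2) * b + x * y * (c - a))
      (y ^ 2 * a - 2 * x * y * b + x ^ 2 * c) (g - c + (y ^ 2 * a - 2 * x * y * b + x ^ 2 * c))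
      (x * p + y * q) (x * q - y * p) (x * l + y * m) (x * m - y * l) n
      ((x ^ 2 - y ^ 2) * u + x * y * (v + w)) (x ^ 2 * v - y ^ 2 * w - 2 * x * y * u)
      (x ^ 2 * w - y ^ 2 * v - 2 * x * y * u) := by
  obtain ⟨X', hX'⟩ := exists_basis_of_combination X
    ![X 0, x • X 1 + y • X 2, x • X 2 - y • X 1, X 3, X 4]
    ![![1, 0, 0, 0, 0], ![0, x, -y, 0, 0], ![0, y, x, 0, 0], ![0, 0, 0, 1, 0], ![0, 0, 0, 0, 1]]
    (by
      have e1 : X 1 = (x ^ 2 + y ^ 2) • X 1 := by rw [hxy, one_smul]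
      have e2 : X 2 = (x ^ 2 + y ^ 2) • X 2 := by rw [hxy, one_smul]
      intro i
      fin_cases i <;> simp [Fin.sum_univ_five]
      · nth_rw 1 [e1]; module
      · nth_rw 1 [e2]; module)
  have e1 : X 1 = x • X' 1 - y • X' 2 := by
    simp only [hX', Matrix.cons_val]
    nth_rw 1 [← one_smul ℝ (X 1), ← hxy]
    module
  have e2 : X 2 = y • X' 1 + x • X' 2 := by
    simp only [hX', Matrix.cons_val]
    nth_rw 1 [← one_smul ℝ (X 2), ← hxy]
    module
  have f0 : X' 0 = X 0 := hX' 0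
  have f1 : X' 1 = x • X 1 + y • X 2 := hX' 1
  have f2 : X' 2 = x • X 2 - y • X 1 := hX' 2
  have f3 : X' 3 = X 3 := hX' 3
  have f4 : X' 4 = X 4 := hX' 4
  have h12 : ⁅X' 1, X' 2⁆ = ⁅X 1, X 2⁆ := by
    have : ⁅X' 1, X' 2⁆ = (x ^ 2 + y ^ 2) • ⁅X 1, X 2⁆ := by
      rw [f1, f2]
      simp only [lie_sub, add_lie, lie_smul, smul_lie, lie_self, ← lie_skew (X 2) (X 1)]
      module
    rw [this, hxy, one_smul]
  refine ⟨X', ?_, ?_, ?_, ?_, ?_, ?_, ?_, ?_, ?_, ?_⟩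
  · conv_lhs => rw [f0, f1, lie_add, lie_smul, lie_smul, h.b01, h.b02, e1, e2, ← f3]
    module
  · conv_lhs => rw [f0, f2, lie_sub, lie_smul, lie_smul, h.b01, h.b02, e1, e2, ← f3]
    module
  · conv_lhs => rw [f0, f3, h.b03, e1, e2, ← f3, ← f4]
    module
  · conv_lhs => rw [f0, f4, h.b04, e1, e2, ← f3]
    module
  · conv_lhs => rw [h12, h.b12, e1, e2, ← f3, ← f4]
    have : a + c = x ^ 2 * a + 2 * x * y * b + y ^ 2 * c +
        (y ^ 2 * a - 2 * x * y * b + x ^ 2 * c) := by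
      linear_combination (-a - c) * hxy
    rw [this]
    module
  · conv_lhs => rw [f1, f3, add_lie, smul_lie, smul_lie, h.b13, h.b23, e1, e2, ← f3]
    match_scalars
    · ring
    · linear_combination (c - g) * hxy
    · ring
  · conv_lhs => rw [f1, f4, add_lie, smul_lie, smul_lie, h.b14, h.b24, e1, e2, ← f3]
    module
  · conv_lhs => rw [f2, f3, sub_lie, smul_lie, smul_lie, h.b13, h.b23, e1, e2, ← f3]
    match_scalars
    · linear_combination (g - c) * hxy
    · ring
    · ring
  · conv_lhs => rw [f2, f4, sub_lie, smul_lie, smul_lie, h.b14, h.b24, e1, e2, ← f3]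
    module
  · rw [f3, f4, h.b34]

end IsAdapted

/-- Polar coordinates. -/
theorem exists_unit_of_ne_zero {s t : ℝ} (h : s ≠ 0 ∨ t ≠ 0) :
    ∃ x y r : ℝ, x ^ 2 + y ^ 2 = 1 ∧ r ≠ 0 ∧ s = r * x ∧ t = r * y := by
  have hpos : 0 < s ^ 2 + t ^ 2 := by
    rcases h with h | h <;> positivity
  have hr : √(s ^ 2 + t ^ 2) ≠ 0 := (Real.sqrt_pos.mpr hpos).ne'
  have hsq := Real.sq_sqrt hpos.le
  refine ⟨s / √(s ^ 2 + t ^ 2), t / √(s ^ 2 + t ^ 2), √(s ^ 2 + t ^ 2), ?_, hr, ?_, ?_⟩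
  · rw [div_pow, div_pow, hsq]
    field_simp
  · field_simp
  · field_simp

namespace IsAdapted

variable {L : Type*} [LieRing L] [LieAlgebra ℝ L] {X : Module.Basis (Fin 5) ℝ L}

theorem eq_zero_of_offDiagonal {a c g p l m n u v w : ℝ}
    (h : IsAdapted X a 0 c g p 0 l m n u v w) : m = 0 ∧ u = 0 := by
  obtain ⟨-, hm, -⟩ := h.jacobi_zero_one_two
  obtain ⟨hu, -⟩ := h.jacobi_zero_one_three
  constructor <;> linarith

/-- A suitable rotation makes the off-diagonal entries `b` and `q` vanish. When `(p, q) ≠ 0`, the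
rotation with `q = 0` is the right one, since the Jacobi identity then gives `b = 0`; otherwise the
symmetric block with entries `a`, `b`, `c` can be diagonalized. -/
theorem exists_diagonal {a b c g p q l m n u v w : ℝ}
    (h : IsAdapted X a b c g p q l m n u v w) :
    ∃ (X' : Module.Basis (Fin 5) ℝ L) (a c g p l n v w : ℝ),
      IsAdapted X' a 0 c g p 0 l 0 n 0 v w := by
  by_cases hpq : p ≠ 0 ∨ q ≠ 0
  · obtain ⟨x, y, r, hxy, hr, rfl, rfl⟩ := exists_unit_of_ne_zero hpq
    obtain ⟨X', h'⟩ := h.rotate hxy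
    have hq : x * (r * y) - y * (r * x) = 0 := by ring
    have hp : x * (r * x) + y * (r * y) = r := by linear_combination r * hxy
    rw [hq, hp] at h'
    obtain ⟨-, h1⟩ := h'.jacobi_zero_three_four
    have hm : x * m - y * l = 0 := by
      rw [mul_zero, sub_zero] at h1
      simpa [hr] using h1
    rw [hm] at h'
    obtain ⟨-, h2, -⟩ := h'.jacobi_zero_one_two
    have hb : (x ^ 2 - y ^ 2) * b + x * y * (c - a) = 0 := by
      refine (mul_eq_zero.mp (?_ : _ * r = 0)).resolve_right hr
      linarith
    rw [hb] at h'
    obtain ⟨-, hu⟩ := h'.eq_zero_of_offDiagonal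
    rw [hu] at h'
    exact ⟨X', _, _, _, _, _, _, _, _, h'⟩
  · push Not at hpq
    obtain ⟨rfl, rfl⟩ := hpq
    obtain ⟨x, y, hxy, hb⟩ : ∃ x y : ℝ, x ^ 2 + y ^ 2 = 1 ∧
        (x ^ 2 - y ^ 2) * b + x * y * (c - a) = 0 := by
      by_cases hb : b = 0
      · exact ⟨1, 0, by norm_num, by simp [hb]⟩
      · -- `(2 b, c - a + √((c - a)² + 4 b²))` is an eigenvector of the symmetric block.
        have hs := Real.sq_sqrt (show 0 ≤ (c - a) ^ 2 + 4 * b ^ 2 by positivity)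
        set s := √((c - a) ^ 2 + 4 * b ^ 2)
        obtain ⟨x, y, r, hxy, hr, hx, hy⟩ := exists_unit_of_ne_zero (s := 2 * b) (t := c - a + s)
          (Or.inl (by simpa using hb))
        refine ⟨x, y, hxy, ?_⟩
        have hr2 : r ^ 2 ≠ 0 := pow_ne_zero 2 hr
        apply mul_left_cancel₀ hr2
        have : r ^ 2 * ((x ^ 2 - y ^ 2) * b + x * y * (c - a)) =
            ((r * x) ^ 2 - (r * y) ^ 2) * b + (r * x) * (r * y) * (c - a) := by ring
        rw [this, ← hx, ← hy]
        linear_combination -b * hs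
    obtain ⟨X', h'⟩ := h.rotate hxy
    rw [hb] at h'
    simp only [mul_zero, sub_zero, add_zero] at h'
    obtain ⟨hm, hu⟩ := h'.eq_zero_of_offDiagonal
    rw [hm, hu] at h'
    exact ⟨X', _, _, _, _, _, _, _, _, h'⟩

/-- The possible parameters in a frame with `b = q = 0`. In the first two cases `c = 0`, and the
matrix of `ad (X 0)` on the span of `X 1` and `X 3`, modulo `X 4`, has rank one or trace zero. The
last four cases are isolated up to scale. -/
theorem cases_of_diagonal {a c g p l n v w : ℝ} (h : IsAdapted X a 0 c g p 0 l 0 n 0 v w) :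
    (c = 0 ∧ p ^ 2 = g * a ∧ a + g ≠ 0) ∨ (c = 0 ∧ g = -a) ∨
    (a ≠ 0 ∧ c = a ∧ g = 3 * a ∧ p = 0) ∨ (a ≠ 0 ∧ c = a ∧ g = 0 ∧ p = 0) ∨
    (a = 0 ∧ c ≠ 0 ∧ g = 0 ∧ p = 0) ∨ (a = 0 ∧ c ≠ 0 ∧ g = c ∧ p = 0) := by
  obtain ⟨hl, -, hn⟩ := h.jacobi_zero_one_two
  obtain ⟨-, hv⟩ := h.jacobi_zero_one_three
  have hw := h.jacobi_zero_two_three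
  have e1 := h.jacobi_zero_one_four
  obtain ⟨e2, e3⟩ := h.jacobi_zero_two_four
  obtain ⟨e4, -⟩ := h.jacobi_zero_three_four
  have e5 := h.jacobi_one_three_four
  obtain rfl : l = -p * (a + g + 2 * c) / 2 := by linarith
  obtain rfl : n = ((a + c) * (a + 2 * c - g) + 2 * p ^ 2) / 2 := by linarith
  obtain rfl : v = (a + g - c) * (a + g - 2 * c) / 2 := by linarith
  obtain rfl : w = (-2 * p ^ 2 - g * (g - a)) / 2 := by linarith
  have f1 : (a + g - c) * (a * (g - 3 * c) - p ^ 2) = 0 := by linear_combination e1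
  have f2 : c * (g * (2 * a - g + c) - 3 * p ^ 2) = 0 := by linear_combination e2
  have f3 : p * c * (a + 2 * c + g) = 0 := by linear_combination e3
  have f4 : p * (a + g - c) * c = 0 := by linear_combination -e4 / 2
  have f5 : (a + g - c) * (g * (a - c) - p ^ 2) = 0 := by linear_combination -e5
  clear e1 e2 e3 e4 e5 hl hn hv hw h
  by_cases hk : a + g - c = 0
  · obtain rfl : c = a + g := by linarith
    by_cases hc : a + g = 0
    · exact Or.inr (Or.inl ⟨hc, by linarith⟩)
    · have hp : p = 0 := by
        have : p * (a + g) * (3 * (a + g)) = 0 := by linear_combination f3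
        simpa [hc] using this
      subst hp
      have : (a + g) * (3 * a * g) = 0 := by linear_combination f2
      simp only [mul_eq_zero, hc, OfNat.ofNat_ne_zero, false_or] at this
      rcases this with rfl | rfl
      · simp_all
      · simp_all
  · have h1 := (mul_eq_zero.mp f1).resolve_left hk
    have h5 := (mul_eq_zero.mp f5).resolve_left hk
    by_cases hc : c = 0
    · subst hc
      exact Or.inl ⟨rfl, by linarith, by simpa using hk⟩
    · have hp : p = 0 := by simpa [hc, hk] using f4
      subst hp
      have hg : g = 3 * a := by
        apply mul_left_cancel₀ hc
        linarith
      subst hg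
      have : a * (a - c) = 0 := by linarith
      rcases mul_eq_zero.mp this with rfl | h0
      · simp_all
      · obtain rfl : a = c := by linarith
        simp_all

end IsAdapted

/-! ### Identification of the normal forms -/

theorem hasBrackets_of_combination {L : Type*} [LieRing L] [LieAlgebra ℝ L]
    (X : Module.Basis (Fin 5) ℝ L) (Z : Fin 5 → L) (M : Fin 5 → Fin 5 → ℝ)
    (h : ∀ i, X i = ∑ j, M i j • Z j) {T : Fin 5 → Fin 5 → Fin 5 → ℝ}
    (hT : ∀ i j, i < j → ⁅Z i, Z j⁆ = ∑ k, T i j k • Z k) : HasBrackets L T := by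
  obtain ⟨Y, hY⟩ := exists_basis_of_combination X Z M h
  refine ⟨Y, fun i j hij => ?_⟩
  simp only [hY]
  exact hT i j hij

namespace IsAdapted

variable {L : Type*} [LieRing L] [LieAlgebra ℝ L] {X : Module.Basis (Fin 5) ℝ L}
  {a b c g p q l m n u v w : ℝ}

theorem b10 (h : IsAdapted X a b c g p q l m n u v w) :
    ⁅X 1, X 0⁆ = -(a • X 1 + b • X 2 + p • X 3) := by
  rw [← lie_skew, h.b01]

theorem b20 (h : IsAdapted X a b c g p q l m n u v w) :
    ⁅X 2, X 0⁆ = -(b • X 1 + c • X 2 + q • X 3) := by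
  rw [← lie_skew, h.b02]

theorem b30 (h : IsAdapted X a b c g p q l m n u v w) :
    ⁅X 3, X 0⁆ = -(p • X 1 + q • X 2 + (g - c) • X 3 + (2 : ℝ) • X 4) := by
  rw [← lie_skew, h.b03]

theorem b40 (h : IsAdapted X a b c g p q l m n u v w) :
    ⁅X 4, X 0⁆ = -(l • X 1 + m • X 2 + n • X 3) := by
  rw [← lie_skew, h.b04]

theorem b21 (h : IsAdapted X a b c g p q l m n u v w) :
    ⁅X 2, X 1⁆ = -((-p) • X 1 + (-q) • X 2 + (a + c) • X 3 + (2 : ℝ) • X 4) := by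
  rw [← lie_skew, h.b12]

theorem b31 (h : IsAdapted X a b c g p q l m n u v w) :
    ⁅X 3, X 1⁆ = -(b • X 1 + (c - a - g) • X 2 + q • X 3) := by
  rw [← lie_skew, h.b13]

theorem b41 (h : IsAdapted X a b c g p q l m n u v w) :
    ⁅X 4, X 1⁆ = -(u • X 1 + v • X 2 + m • X 3) := by
  rw [← lie_skew, h.b14]

theorem b32 (h : IsAdapted X a b c g p q l m n u v w) :
    ⁅X 3, X 2⁆ = -(g • X 1 + (-b) • X 2 + (-p) • X 3) := by
  rw [← lie_skew, h.b23]

theorem b42 (h : IsAdapted X a b c g p q l m n u v w) :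
    ⁅X 4, X 2⁆ = -(w • X 1 + (-u) • X 2 + (-l) • X 3) := by
  rw [← lie_skew, h.b24]

theorem b43 (h : IsAdapted X a b c g p q l m n u v w) : ⁅X 4, X 3⁆ = 0 := by
  rw [← lie_skew, h.b34, neg_zero]

theorem hasBrackets_h1 (h : IsAdapted X 0 0 0 0 0 0 0 0 0 0 0 0) : HasBrackets L h1.T := by
  refine hasBrackets_of_combination X ![X 0, X 1, X 2, X 3, (2 : ℝ) • X 4]
    ![![1, 0, 0, 0, 0], ![0, 1, 0, 0, 0], ![0, 0, 1, 0, 0], ![0, 0, 0, 1, 0], ![0, 0, 0, 0, 2⁻¹]]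
    (fun i => ?_) (fun i j hij => ?_)
  · fin_cases i <;> simp [Fin.sum_univ_five]
  · fin_cases i <;> fin_cases j <;>
      simp [h1, h1Table, stdVec, Pi.single_apply, h.b01, h.b02, h.b03,
        h.b04, h.b12, h.b13, h.b14, h.b23, h.b24, h.b34] at hij ⊢

theorem hasBrackets_h2 {a : ℝ} (ha : a ≠ 0) (h : IsAdapted X a 0 a 0 0 0 0 0 (3 * a ^ 2) 0 0 0) :
    HasBrackets L h2.T := by
  refine hasBrackets_of_combination X
    ![(2 * a) • X 3 + (2 : ℝ) • X 4, X 1, X 2, (3 * a) • X 3 - (2 : ℝ) • X 4, (-a⁻¹) • X 0]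
    ![![0, 0, 0, 0, -a], ![0, 1, 0, 0, 0], ![0, 0, 1, 0, 0], ![(5 * a)⁻¹, 0, 0, (5 * a)⁻¹, 0],
      ![3 / 10, 0, 0, -(1 / 5), 0]]
    (fun i => ?_) (fun i j hij => ?_)
  · fin_cases i <;> simp [Fin.sum_univ_five]
    all_goals match_scalars <;> field_simp <;> norm_num
  · fin_cases i <;> fin_cases j <;>
      simp [h2, h2Table, stdVec, Pi.single_apply,
        h.b12, h.b13, h.b14, h.b23, h.b24, h.b34, h.b10, h.b20, h.b30, h.b40, h.b31,
        h.b41, h.b32, h.b42, h.b43] at hij ⊢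
    all_goals match_scalars <;> field_simp <;> ring

theorem hasBrackets_h3 {a : ℝ} (ha : a ≠ 0)
    (h : IsAdapted X a 0 a (3 * a) 0 0 0 0 0 0 (3 * a ^ 2) (-3 * a ^ 2)) :
    HasBrackets L h3.T := by
  refine hasBrackets_of_combination X
    ![(2 * a) • X 3 + (2 : ℝ) • X 4, X 1, X 2, (-a⁻¹) • X 0, (-(3 * a ^ 2)⁻¹) • X 4]
    ![![0, 0, 0, -a, 0], ![0, 1, 0, 0, 0], ![0, 0, 1, 0, 0], ![(2 * a)⁻¹, 0, 0, 0, 3 * a],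
      ![0, 0, 0, 0, -3 * a ^ 2]]
    (fun i => ?_) (fun i j hij => ?_)
  · fin_cases i <;> simp [Fin.sum_univ_five]
    all_goals match_scalars <;> field_simp <;> norm_num
  · fin_cases i <;> fin_cases j <;>
      simp [h3, h3Table, stdVec, Pi.single_apply,
        h.b04, h.b12, h.b14, h.b24, h.b34, h.b10, h.b20, h.b30, h.b40, h.b31,
        h.b41, h.b32, h.b42] at hij ⊢
    all_goals match_scalars <;> field_simp <;> ring

theorem hasBrackets_h5 {a : ℝ} (ha : a ≠ 0)
    (h : IsAdapted X a 0 0 0 0 0 0 0 (a ^ 2 / 2) 0 (a ^ 2 / 2) 0) :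
    HasBrackets L h5.T := by
  refine hasBrackets_of_combination X
    ![(-2 * a ^ 3) • X 3 + (-4 * a ^ 2) • X 4, (2 * a ^ 2) • X 2, a • X 3 - (2 : ℝ) • X 4, X 1,
      (-a⁻¹) • X 0]
    ![![0, 0, 0, 0, -a], ![0, 0, 0, 1, 0], ![0, (2 * a ^ 2)⁻¹, 0, 0, 0],
      ![-(4 * a ^ 3)⁻¹, 0, (2 * a)⁻¹, 0, 0], ![-(8 * a ^ 2)⁻¹, 0, -(1 / 4), 0, 0]]
    (fun i => ?_) (fun i j hij => ?_)
  · fin_cases i <;> simp [Fin.sum_univ_five]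
    all_goals match_scalars <;> field_simp <;> norm_num
  · fin_cases i <;> fin_cases j <;>
      simp [h5, h5Table, stdVec, Pi.single_apply,
        h.b23, h.b24, h.b34, h.b10, h.b20, h.b30, h.b40, h.b21, h.b31,
        h.b41, h.b32, h.b42, h.b43] at hij ⊢
    all_goals match_scalars <;> field_simp <;> ring

/-- The joint eigenvectors of `X 0` and `X 2` on the abelian ideal spanned by `X 1`, `X 3`, `X 4`
are `√3 a X 1 ± (a X 3 + 2 X 4)` and `a X 3 - X 4`. -/
theorem hasBrackets_h4 {a : ℝ} (ha : a ≠ 0)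
    (h : IsAdapted X a 0 0 (-a) 0 0 0 0 (a ^ 2) 0 0 (-a ^ 2)) :
    HasBrackets L h4.T := by
  have hs : √3 ^ 2 = 3 := Real.sq_sqrt (by norm_num)
  refine hasBrackets_of_combination X
    ![(√3 * a) • X 1 + a • X 3 + (2 : ℝ) • X 4, (√3 * a) • X 1 - a • X 3 - (2 : ℝ) • X 4,
      a • X 3 - X 4, (-(2 * a)⁻¹) • X 0 + (√3 / (6 * a)) • X 2,
      (-(2 * a)⁻¹) • X 0 - (√3 / (6 * a)) • X 2]
    ![![0, 0, 0, -a, -a], ![√3 / (6 * a), √3 / (6 * a), 0, 0, 0],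
      ![0, 0, 0, √3 * a, -√3 * a],
      ![(6 * a)⁻¹, -(6 * a)⁻¹, 2 / (3 * a), 0, 0], ![1 / 6, -(1 / 6), -(1 / 3), 0, 0]]
    (fun i => ?_) (fun i j hij => ?_)
  · fin_cases i <;> simp [Fin.sum_univ_five]
    all_goals match_scalars <;> field_simp <;> ring_nf <;> norm_num [hs]
  · fin_cases i <;> fin_cases j <;>
      simp [h4, h4Table, stdVec, Pi.single_apply, h.b02,
        h.b12, h.b13, h.b14, h.b34, h.b10, h.b20, h.b30, h.b40, h.b31,
        h.b41, h.b32, h.b42, h.b43] at hij ⊢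
    all_goals match_scalars <;> field_simp <;> ring_nf <;> simp only [hs] <;> ring

end IsAdapted

/-! ### Solvable algebras with an adapted frame -/

/-- Three vectors that generate each other by brackets stay in every term of the derived series. -/
theorem not_isSolvable_of_cyclic {L : Type*} [LieRing L] [LieAlgebra ℝ L] {x y z : L}
    {r s t : ℝ} (hr : r ≠ 0) (hs : s ≠ 0) (ht : t ≠ 0) (hx : ⁅y, z⁆ = r • x) (hy : ⁅z, x⁆ = s • y)
    (hz : ⁅x, y⁆ = t • z) (hx0 : x ≠ 0) :
    ¬ LieAlgebra.IsSolvable L := by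
  intro hsol
  have hmem (k : ℕ) : x ∈ LieAlgebra.derivedSeries ℝ L k ∧ y ∈ LieAlgebra.derivedSeries ℝ L k ∧
      z ∈ LieAlgebra.derivedSeries ℝ L k := by
    induction k with
    | zero => simp
    | succ k ih =>
      have aux {u v w : L} {c : ℝ} (hc : c ≠ 0) (h : ⁅u, v⁆ = c • w)
          (hu : u ∈ LieAlgebra.derivedSeries ℝ L k) (hv : v ∈ LieAlgebra.derivedSeries ℝ L k) :
          w ∈ LieAlgebra.derivedSeries ℝ L (k + 1) := by
        have : w = c⁻¹ • ⁅u, v⁆ := by rw [h, smul_smul, inv_mul_cancel₀ hc, one_smul]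
        rw [this, LieAlgebra.derivedSeries_def, LieAlgebra.derivedSeriesOfIdeal_succ]
        exact Submodule.smul_mem _ _ (LieSubmodule.lie_mem_lie hu hv)
      exact ⟨aux hr hx ih.2.1 ih.2.2, aux hs hy ih.2.2 ih.1, aux ht hz ih.1 ih.2.1⟩
  obtain ⟨k, hk⟩ := LieAlgebra.IsSolvable.solvable ℝ L
  have := (hmem k).1
  rw [hk, LieSubmodule.mem_bot] at this
  exact hx0 this

namespace IsAdapted

variable {L : Type*} [LieRing L] [LieAlgebra ℝ L] {X : Module.Basis (Fin 5) ℝ L}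

/-- In the rank-one case with `g ≠ 0`, the vectors `X 2`, `g X 1 - p X 3` and `X 4` span a simple
subalgebra. -/
theorem not_isSolvable {a g p : ℝ} (hp : p ^ 2 = g * a) (hg : g ≠ 0) (hk : a + g ≠ 0)
    (h : IsAdapted X a 0 0 g p 0 (-p * (a + g) / 2) 0 (a * (a + g) / 2) 0 ((a + g) ^ 2 / 2)
      (-g * (a + g) / 2)) : ¬ LieAlgebra.IsSolvable L := by
  refine not_isSolvable_of_cyclic (x := X 2) (y := g • X 1 - p • X 3) (z := X 4)
    (r := g * (a + g) ^ 2 / 2) (s := (a + g) / 2) (t := -2 * g) (by positivity)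
    (div_ne_zero hk two_ne_zero) (by simpa using hg) ?_ ?_ ?_ (X.ne_zero 2)
  · rw [sub_lie, smul_lie, smul_lie, h.b14, h.b34]
    module
  · rw [h.b42]
    module
  · rw [lie_sub, lie_smul, lie_smul, h.b21, h.b23]
    match_scalars
    · ring
    · ring
    · linear_combination hp
    · ring

/-- In the trace-zero case the covector dual to `X 2` is closed as well, and the frame can be
rotated so that it starts with any combination of the two closed covectors. The pair `(a, p)` turns
by three times the angle. -/
theorem rotate_closed {a p N : ℝ} (h : IsAdapted X a 0 0 (-a) p 0 0 0 N 0 0 (-N)) {x y : ℝ}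
    (hxy : x ^ 2 + y ^ 2 = 1) : ∃ X' : Module.Basis (Fin 5) ℝ L,
      IsAdapted X' ((x ^ 3 - 3 * x * y ^ 2) * a + (3 * x ^ 2 * y - y ^ 3) * p) 0 0
        (-((x ^ 3 - 3 * x * y ^ 2) * a + (3 * x ^ 2 * y - y ^ 3) * p))
        ((x ^ 3 - 3 * x * y ^ 2) * p - (3 * x ^ 2 * y - y ^ 3) * a) 0 0 0 N 0 0 (-N) := by
  obtain ⟨X', hX'⟩ := exists_basis_of_combination X
    ![x • X 0 + y • X 2, x • X 1 + y • X 3, x • X 2 - y • X 0, x • X 3 - y • X 1, X 4]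
    ![![x, 0, -y, 0, 0], ![0, x, 0, -y, 0], ![y, 0, x, 0, 0], ![0, y, 0, x, 0], ![0, 0, 0, 0, 1]]
    (by
      have e (i : Fin 5) : X i = (x ^ 2 + y ^ 2) • X i := by rw [hxy, one_smul]
      intro i
      fin_cases i <;> simp [Fin.sum_univ_five]
      · nth_rw 1 [e 0]; module
      · nth_rw 1 [e 1]; module
      · nth_rw 1 [e 2]; module
      · nth_rw 1 [e 3]; module)
  have f0 : X' 0 = x • X 0 + y • X 2 := hX' 0
  have f1 : X' 1 = x • X 1 + y • X 3 := hX' 1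
  have f2 : X' 2 = x • X 2 - y • X 0 := hX' 2
  have f3 : X' 3 = x • X 3 - y • X 1 := hX' 3
  have f4 : X' 4 = X 4 := hX' 4
  refine ⟨X', ?_, ?_, ?_, ?_, ?_, ?_, ?_, ?_, ?_, ?_⟩
  all_goals
    simp only [f0, f1, f2, f3, f4, add_lie, sub_lie, lie_add, lie_sub, smul_lie, lie_smul, lie_self,
      h.b01, h.b02, h.b03, h.b04, h.b12, h.b13, h.b14, h.b23, h.b24, h.b34, h.b10, h.b20, h.b30,
      h.b21, h.b31, h.b32]
  all_goals
    match_scalars <;> first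
      | ring1
      | linear_combination 2 * hxy
      | linear_combination -((x ^ 2 - y ^ 2) * a + 2 * x * y * p) * hxy
      | linear_combination ((x ^ 2 - y ^ 2) * a + 2 * x * y * p) * hxy
      | linear_combination -((x ^ 2 - y ^ 2) * p - 2 * x * y * a) * hxy
      | linear_combination ((x ^ 2 - y ^ 2) * p - 2 * x * y * a) * hxy

/-- A solvable Lie algebra with an adapted frame is one of the five algebras. -/
theorem hasBrackets_of_isSolvable [hsol : LieAlgebra.IsSolvable L]
    {a b c g p q l m n u v w : ℝ} (h : IsAdapted X a b c g p q l m n u v w) :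
    HasBrackets L h1.T ∨ HasBrackets L h2.T ∨ HasBrackets L h3.T ∨ HasBrackets L h4.T ∨
      HasBrackets L h5.T := by
  obtain ⟨X, a, c, g, p, l, n, v, w, h⟩ := h.exists_diagonal
  have hcases := h.cases_of_diagonal
  obtain ⟨hl, -, hn⟩ := h.jacobi_zero_one_two
  obtain ⟨-, hv⟩ := h.jacobi_zero_one_three
  have hw := h.jacobi_zero_two_three
  obtain rfl : l = -p * (a + g + 2 * c) / 2 := by linarith
  obtain rfl : n = ((a + c) * (a + 2 * c - g) + 2 * p ^ 2) / 2 := by linarith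
  obtain rfl : v = (a + g - c) * (a + g - 2 * c) / 2 := by linarith
  obtain rfl : w = (-2 * p ^ 2 - g * (g - a)) / 2 := by linarith
  clear hl hn hv hw
  have hcongr {X : Module.Basis (Fin 5) ℝ L} {a c g p l n v w a' c' g' p' l' n' v' w' : ℝ}
      (h : IsAdapted X a 0 c g p 0 l 0 n 0 v w) (ha : a = a') (hc : c = c') (hg : g = g')
      (hp : p = p') (hl : l = l') (hn : n = n') (hv : v = v') (hw : w = w') :
      IsAdapted X a' 0 c' g' p' 0 l' 0 n' 0 v' w' := by
    subst_vars
    exact h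
  rcases hcases with ⟨rfl, hp, hk⟩ | ⟨rfl, rfl⟩ | ⟨ha, rfl, rfl, rfl⟩ | ⟨ha, rfl, rfl, rfl⟩ |
    ⟨rfl, hc, rfl, rfl⟩ | ⟨rfl, hc, rfl, rfl⟩
  · by_cases hg : g = 0
    · subst hg
      obtain rfl : p = 0 := by simpa using hp
      rw [add_zero] at hk
      refine Or.inr (Or.inr (Or.inr (Or.inr (hasBrackets_h5 hk
        (hcongr h ?_ ?_ ?_ ?_ ?_ ?_ ?_ ?_)))))
      all_goals ring
    · refine absurd hsol (not_isSolvable hp hg hk (hcongr h ?_ ?_ ?_ ?_ ?_ ?_ ?_ ?_))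
      all_goals linarith
  · have h : IsAdapted X a 0 0 (-a) p 0 0 0 (a ^ 2 + p ^ 2) 0 0 (-(a ^ 2 + p ^ 2)) := by
      refine hcongr h ?_ ?_ ?_ ?_ ?_ ?_ ?_ ?_
      all_goals ring
    by_cases hap : a = 0 ∧ p = 0
    · obtain ⟨rfl, rfl⟩ := hap
      refine Or.inl (hasBrackets_h1 (hcongr h ?_ ?_ ?_ ?_ ?_ ?_ ?_ ?_))
      all_goals ring
    · -- Rotating by a third of the argument of `a + p i` makes `p` vanish.
      obtain ⟨z, hz⟩ := IsAlgClosed.exists_pow_nat_eq (⟨a, p⟩ : ℂ) (show 0 < 3 by norm_num)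
      have hza : z.re ^ 3 - 3 * z.re * z.im ^ 2 = a := by
        have := congrArg Complex.re hz
        simp only [pow_succ, pow_zero, one_mul, Complex.mul_re, Complex.mul_im] at this
        linarith
      have hzp : 3 * z.re ^ 2 * z.im - z.im ^ 3 = p := by
        have := congrArg Complex.im hz
        simp only [pow_succ, pow_zero, one_mul, Complex.mul_re, Complex.mul_im] at this
        linarith
      have hz0 : z.re ≠ 0 ∨ z.im ≠ 0 := by
        by_contra! h0
        simp only [h0.1, h0.2] at hza hzp
        exact hap ⟨by linarith, by linarith⟩
      obtain ⟨x, y, r, hxy, hr, hx, hy⟩ := exists_unit_of_ne_zero hz0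
      rw [hx, hy] at hza hzp
      obtain ⟨X', h'⟩ := h.rotate_closed hxy
      have hsum : (x ^ 3 - 3 * x * y ^ 2) ^ 2 + (3 * x ^ 2 * y - y ^ 3) ^ 2 = 1 := by
        have : (x ^ 3 - 3 * x * y ^ 2) ^ 2 + (3 * x ^ 2 * y - y ^ 3) ^ 2 = (x ^ 2 + y ^ 2) ^ 3 := by
          ring
        rw [this, hxy, one_pow]
      have ha' : a = r ^ 3 * (x ^ 3 - 3 * x * y ^ 2) := by rw [← hza]; ring
      have hp' : p = r ^ 3 * (3 * x ^ 2 * y - y ^ 3) := by rw [← hzp]; ring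
      set s := x ^ 3 - 3 * x * y ^ 2
      set t := 3 * x ^ 2 * y - y ^ 3
      refine Or.inr (Or.inr (Or.inr (Or.inl (hasBrackets_h4 (pow_ne_zero 3 hr)
        (hcongr h' ?_ rfl ?_ ?_ rfl ?_ rfl ?_)))))
      · rw [ha', hp']; linear_combination r ^ 3 * hsum
      · rw [ha', hp']; linear_combination -r ^ 3 * hsum
      · rw [ha', hp']; ring
      · rw [ha', hp']; linear_combination (r ^ 3) ^ 2 * hsum
      · rw [ha', hp']; linear_combination -(r ^ 3) ^ 2 * hsum
  · refine Or.inr (Or.inr (Or.inl (hasBrackets_h3 ha (hcongr h ?_ ?_ ?_ ?_ ?_ ?_ ?_ ?_))))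
    all_goals ring
  · refine Or.inr (Or.inl (hasBrackets_h2 ha (hcongr h ?_ ?_ ?_ ?_ ?_ ?_ ?_ ?_)))
    all_goals ring
  · -- The quarter turn exchanges `a` and `c`.
    obtain ⟨X', h'⟩ := h.rotate (show (0 : ℝ) ^ 2 + 1 ^ 2 = 1 by norm_num)
    refine Or.inr (Or.inr (Or.inr (Or.inl (hasBrackets_h4 (X := X') hc ?_))))
    convert h' using 1
    all_goals ring
  · -- The quarter turn exchanges `a` and `c`.
    obtain ⟨X', h'⟩ := h.rotate (show (0 : ℝ) ^ 2 + 1 ^ 2 = 1 by norm_num)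
    refine Or.inr (Or.inr (Or.inr (Or.inr (hasBrackets_h5 (X := X') hc ?_))))
    convert h' using 1
    all_goals ring

end IsAdapted

/-! ### The hypo-contact structure of an adapted basis -/

namespace IsAdapted

variable {L : Type*} [LieRing L] [LieAlgebra ℝ L] {X : Module.Basis (Fin 5) ℝ L}
  {a b c g p q l m n u v w : ℝ}

/-- The two-form `e_i ∧ e_j`, where `e_0, …, e_4` is the basis dual to `X`. -/
noncomputable def coordTwoForm (X : Module.Basis (Fin 5) ℝ L) (i j : Fin 5) :
    L [⋀^Fin 2]→ₗ[ℝ] ℝ :=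
  Matrix.detRowAlternating.compLinearMap (LinearMap.pi ![X.coord i, X.coord j])

theorem coordTwoForm_apply (X : Module.Basis (Fin 5) ℝ L) (i j : Fin 5) (x y : L) :
    coordTwoForm X i j ![x, y] = X.coord i x * X.coord j y - X.coord i y * X.coord j x := by
  refine (Matrix.det_fin_two (R := ℝ) _).trans ?_
  change X.coord i x * X.coord j y - X.coord j x * X.coord i y = _
  ring

/-- The bracket in coordinates; `e i j` is the value of `e_i ∧ e_j` at `(x, y)`. -/
theorem lie_eq (h : IsAdapted X a b c g p q l m n u v w) (x y : L) (e : Fin 5 → Fin 5 → ℝ)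
    (he : ∀ i j, e i j = X.coord i x * X.coord j y - X.coord i y * X.coord j x) :
    ⁅x, y⁆ = (a * e 0 1 + b * e 0 2 + p * e 0 3 + l * e 0 4 - p * e 1 2 + b * e 1 3 + u * e 1 4 +
        g * e 2 3 + w * e 2 4) • X 1 +
      (b * e 0 1 + c * e 0 2 + q * e 0 3 + m * e 0 4 - q * e 1 2 + (c - a - g) * e 1 3 +
        v * e 1 4 - b * e 2 3 - u * e 2 4) • X 2 +
      (p * e 0 1 + q * e 0 2 + (g - c) * e 0 3 + n * e 0 4 + (a + c) * e 1 2 + q * e 1 3 +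
        m * e 1 4 - p * e 2 3 - l * e 2 4) • X 3 + (2 * e 0 3 + 2 * e 1 2) • X 4 := by
  simp only [he, Module.Basis.coord_apply]
  conv_lhs => rw [← X.sum_repr x, ← X.sum_repr y, Fin.sum_univ_five, Fin.sum_univ_five]
  simp only [lie_add, add_lie, lie_smul, smul_lie, lie_self, h.b01, h.b02, h.b03, h.b04, h.b12,
    h.b13, h.b14, h.b23, h.b24, h.b34, h.b10, h.b20, h.b30, h.b40, h.b21, h.b31, h.b41, h.b32,
    h.b42, h.b43]
  module

/-- The `SU(2)`-structure with `η = e_4`, `ω₁ = e_0 ∧ e_1 + e_2 ∧ e_3`, `ω₂ = e_0 ∧ e_2 - e_1 ∧ e_3`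
and `ω₃ = e_0 ∧ e_3 + e_1 ∧ e_2`. -/
noncomputable def basisSU2Structure (X : Module.Basis (Fin 5) ℝ L) : SU2Structure L :=
  let η : L [⋀^Fin 1]→ₗ[ℝ] ℝ := AlternatingMap.ofSubsingleton ℝ L ℝ (0 : Fin 1) (X.coord 4)
  let ω : Fin 3 → L [⋀^Fin 2]→ₗ[ℝ] ℝ := ![coordTwoForm X 0 1 + coordTwoForm X 2 3,
    coordTwoForm X 0 2 - coordTwoForm X 1 3, coordTwoForm X 0 3 + coordTwoForm X 1 2]
  have hη (x : L) : η ![x] = X.coord 4 x := rfl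
  have hvol : wedge (m := 2) (n := 2) (ω 0) (ω 0) (fun i => X i.castSucc) = 2 := by
    rw [wedge_two_two_apply]
    change ω 0 ![X 0, X 1] * ω 0 ![X 2, X 3] - ω 0 ![X 0, X 2] * ω 0 ![X 1, X 3] +
      ω 0 ![X 0, X 3] * ω 0 ![X 1, X 2] + ω 0 ![X 1, X 2] * ω 0 ![X 0, X 3] -
      ω 0 ![X 1, X 3] * ω 0 ![X 0, X 2] + ω 0 ![X 2, X 3] * ω 0 ![X 0, X 1] = 2
    simp [ω, coordTwoForm_apply]
    norm_num
  { η := η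
    ω := ω
    eta_ne_zero := by
      intro h0
      have := congrArg (fun α => α ![X 4]) h0
      simp [hη] at this
    wedge_eq := by
      refine ⟨wedge (m := 2) (n := 2) (ω 0) (ω 0), ?_, ?_, ?_⟩
      · intro h0
        rw [h0] at hvol
        simp at hvol
      · intro i j
        ext x
        fin_cases i <;> fin_cases j <;> simp [wedge_two_two_apply, ω, coordTwoForm_apply] <;> ring
      · intro h0
        have h1 := DFunLike.congr_fun h0 (fun i => X i)
        rw [wedge_four_one_apply_of_eq_zero, hvol, hη] at h1
        · simp at h1
        · intro i
          rw [hη, Module.Basis.coord_apply, Module.Basis.repr_self, Finsupp.single_eq_of_ne]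
          exact (Fin.castSucc_lt_last i).ne'
    nonneg := by
      intro x y hxy
      have h0 := hxy (X 0)
      have h1 := hxy (X 1)
      have h2 := hxy (X 2)
      have h3 := hxy (X 3)
      simp [ω, coordTwoForm_apply] at h0 h1 h2 h3 ⊢
      -- The hypothesis determines `y` on the contact distribution, and `ω₂(x, y)` becomes a sum of
      -- four squares.
      have h4 : X.repr y 3 = -X.repr x 1 := by linarith
      rw [← h0, ← h1, ← h3, h4]
      nlinarith [sq_nonneg (X.repr x 0), sq_nonneg (X.repr x 1), sq_nonneg (X.repr x 2),
        sq_nonneg (X.repr x 3)] }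

/-- In coordinates the hypo-contact equations are polynomial identities. -/
theorem hypoContactStructure (h : IsAdapted X a b c g p q l m n u v w) :
    Nonempty (HypoContactStructure L) := by
  have hη (x : L) : (basisSU2Structure X).η ![x] = X.coord 4 x := rfl
  have h0 (x y : L) : (basisSU2Structure X).ω 0 ![x, y] = X.coord 0 x * X.coord 1 y -
    X.coord 0 y * X.coord 1 x + (X.coord 2 x * X.coord 3 y - X.coord 2 y * X.coord 3 x) := by
    simp [basisSU2Structure, coordTwoForm_apply]
  have h1 (x y : L) : (basisSU2Structure X).ω 1 ![x, y] = X.coord 0 x * X.coord 2 y -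
    X.coord 0 y * X.coord 2 x - (X.coord 1 x * X.coord 3 y - X.coord 1 y * X.coord 3 x) := by
    simp [basisSU2Structure, coordTwoForm_apply]
  have h2 (x y : L) : (basisSU2Structure X).ω 2 ![x, y] = X.coord 0 x * X.coord 3 y -
    X.coord 0 y * X.coord 3 x + (X.coord 1 x * X.coord 2 y - X.coord 1 y * X.coord 2 x) := by
    simp [basisSU2Structure, coordTwoForm_apply]
  have e0 (x y : L) : X.coord 0 ⁅x, y⁆ = 0 := by
    rw [h.lie_eq x y _ (fun _ _ => rfl)]
    simp
  have e1 (x y : L) := congrArg (X.coord 1) (h.lie_eq x y _ (fun _ _ => rfl))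
  have e2 (x y : L) := congrArg (X.coord 2) (h.lie_eq x y _ (fun _ _ => rfl))
  have e3 (x y : L) := congrArg (X.coord 3) (h.lie_eq x y _ (fun _ _ => rfl))
  have e4 (x y : L) := congrArg (X.coord 4) (h.lie_eq x y _ (fun _ _ => rfl))
  simp [-Module.Basis.coord_apply, Module.Basis.coord_apply X _ (X _)] at e1 e2 e3 e4
  refine ⟨⟨basisSU2Structure X, ?_, ?_, ?_⟩⟩
  · intro x
    rw [extD_one_apply, fin_two_eta x, hη, e4, h2]
    simp only [Matrix.cons_val]
    ring
  · intro x
    rw [extD_three_apply]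
    simp only [wedge_one_two_apply, hη, h0, Matrix.cons_val, e0, e1, e2, e3, e4]
    ring
  · intro x
    rw [extD_three_apply]
    simp only [wedge_one_two_apply, hη, h1, Matrix.cons_val, e0, e1, e2, e3, e4]
    ring

end IsAdapted

/-! ### Adapted bases of the listed algebras -/

/-- The table of brackets, completed by antisymmetry. -/
theorem lie_eq_sum {L : Type*} [LieRing L] [LieAlgebra ℝ L] {Y : Fin 5 → L}
    {T : Fin 5 → Fin 5 → Fin 5 → ℝ} (hY : ∀ i j, i < j → ⁅Y i, Y j⁆ = ∑ k, T i j k • Y k)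
    (i j : Fin 5) :
    ⁅Y i, Y j⁆ = ∑ k, (if i < j then T i j k else if j < i then -T j i k else 0) • Y k := by
  rcases lt_trichotomy i j with h | rfl | h
  · simp [h, hY i j h]
  · simp
  · rw [← lie_skew, hY j i h]
    simp [h, h.not_gt]

namespace HasBrackets

variable {L : Type*} [LieRing L] [LieAlgebra ℝ L]

theorem exists_adapted_h1 (h : HasBrackets L h1.T) :
    ∃ X : Module.Basis (Fin 5) ℝ L, IsAdapted X 0 0 0 0 0 0 0 0 0 0 0 0 := by
  obtain ⟨Y, hY⟩ := h
  have key := lie_eq_sum hY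
  obtain ⟨X, hX⟩ := exists_basis_of_combination Y ![Y 0, Y 1, Y 2, Y 3, (1 / 2 : ℝ) • Y 4]
    ![![1, 0, 0, 0, 0], ![0, 1, 0, 0, 0], ![0, 0, 1, 0, 0], ![0, 0, 0, 1, 0], ![0, 0, 0, 0, 2]]
    (fun i => by fin_cases i <;> simp [Fin.sum_univ_five])
  refine ⟨X, ?_, ?_, ?_, ?_, ?_, ?_, ?_, ?_, ?_, ?_⟩ <;>
    simp [hX, key, h1, h1Table, stdVec, Pi.single_apply]

theorem exists_adapted_h2 (h : HasBrackets L h2.T) :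
    ∃ X : Module.Basis (Fin 5) ℝ L, IsAdapted X 1 0 1 0 0 0 0 0 3 0 0 0 := by
  obtain ⟨Y, hY⟩ := h
  have key := lie_eq_sum hY
  obtain ⟨X, hX⟩ := exists_basis_of_combination Y
    ![-Y 4, Y 1, Y 2, (1 / 5 : ℝ) • (Y 0 + Y 3), (1 / 10 : ℝ) • ((3 : ℝ) • Y 0 - (2 : ℝ) • Y 3)]
    ![![0, 0, 0, 2, 2], ![0, 1, 0, 0, 0], ![0, 0, 1, 0, 0], ![0, 0, 0, 3, -2], ![-1, 0, 0, 0, 0]]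
    (fun i => by fin_cases i <;> simp [Fin.sum_univ_five] <;> module)
  refine ⟨X, ?_, ?_, ?_, ?_, ?_, ?_, ?_, ?_, ?_, ?_⟩ <;>
    simp [hX, key, h2, h2Table, stdVec, Pi.single_apply]
  all_goals module

theorem exists_adapted_h3 (h : HasBrackets L h3.T) :
    ∃ X : Module.Basis (Fin 5) ℝ L, IsAdapted X 1 0 1 3 0 0 0 0 0 0 3 (-3) := by
  obtain ⟨Y, hY⟩ := h
  have key := lie_eq_sum hY
  obtain ⟨X, hX⟩ := exists_basis_of_combination Y
    ![-Y 3, Y 1, Y 2, (1 / 2 : ℝ) • Y 0 + (3 : ℝ) • Y 4, (-3 : ℝ) • Y 4]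
    ![![0, 0, 0, 2, 2], ![0, 1, 0, 0, 0], ![0, 0, 1, 0, 0], ![-1, 0, 0, 0, 0],
      ![0, 0, 0, 0, -1 / 3]]
    (fun i => by
      fin_cases i <;> simp [Fin.sum_univ_five]
      module)
  refine ⟨X, ?_, ?_, ?_, ?_, ?_, ?_, ?_, ?_, ?_, ?_⟩ <;>
    simp [hX, key, h3, h3Table, stdVec, Pi.single_apply]
  all_goals module

theorem exists_adapted_h4 (h : HasBrackets L h4.T) :
    ∃ X : Module.Basis (Fin 5) ℝ L, IsAdapted X 1 0 0 (-1) 0 0 0 0 1 0 0 (-1) := by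
  have hs : √3 ^ 2 = 3 := Real.sq_sqrt (by norm_num)
  obtain ⟨Y, hY⟩ := h
  have key := lie_eq_sum hY
  obtain ⟨X, hX⟩ := exists_basis_of_combination Y
    ![-(Y 3 + Y 4), (√3 / 6) • (Y 0 + Y 1), √3 • (Y 3 - Y 4),
      (1 / 6 : ℝ) • (Y 0 - Y 1) + (2 / 3 : ℝ) • Y 2, (1 / 6 : ℝ) • (Y 0 - Y 1) - (1 / 3 : ℝ) • Y 2]
    ![![0, √3, 0, 1, 2], ![0, √3, 0, -1, -2], ![0, 0, 0, 1, -1], ![-1 / 2, 0, √3 / 6, 0, 0],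
      ![-1 / 2, 0, -√3 / 6, 0, 0]]
    (fun i => by
      fin_cases i <;> simp [Fin.sum_univ_five] <;> match_scalars <;> ring_nf <;> norm_num [hs])
  refine ⟨X, ?_, ?_, ?_, ?_, ?_, ?_, ?_, ?_, ?_, ?_⟩ <;>
    simp [hX, key, h4, h4Table, stdVec, Pi.single_apply]
  all_goals match_scalars <;> ring_nf <;> norm_num [hs]

theorem exists_adapted_h5 (h : HasBrackets L h5.T) :
    ∃ X : Module.Basis (Fin 5) ℝ L, IsAdapted X 1 0 0 0 0 0 0 0 (1 / 2) 0 (1 / 2) 0 := by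
  obtain ⟨Y, hY⟩ := h
  have key := lie_eq_sum hY
  obtain ⟨X, hX⟩ := exists_basis_of_combination Y
    ![-Y 4, Y 3, (1 / 2 : ℝ) • Y 1, (-1 / 4 : ℝ) • Y 0 + (1 / 2 : ℝ) • Y 2,
      (-1 / 8 : ℝ) • Y 0 - (1 / 4 : ℝ) • Y 2]
    ![![0, 0, 0, -2, -4], ![0, 0, 2, 0, 0], ![0, 0, 0, 1, -2], ![0, 1, 0, 0, 0],
      ![-1, 0, 0, 0, 0]]
    (fun i => by fin_cases i <;> simp [Fin.sum_univ_five] <;> module)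
  refine ⟨X, ?_, ?_, ?_, ?_, ?_, ?_, ?_, ?_, ?_, ?_⟩ <;>
    simp [hX, key, h5, h5Table, stdVec, Pi.single_apply]
  all_goals module

end HasBrackets

/-! ### Solvability, nilpotency and centers of the listed algebras -/

theorem isSolvable_of_chain {L : Type*} [LieRing L] [LieAlgebra ℝ L] (P Q : Submodule ℝ L)
    (hP : ∀ x y : L, ⁅x, y⁆ ∈ P) (hQ : ∀ x ∈ P, ∀ y ∈ P, ⁅x, y⁆ ∈ Q)
    (h0 : ∀ x ∈ Q, ∀ y ∈ Q, ⁅x, y⁆ = 0) : LieAlgebra.IsSolvable L := by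
  have step (k : ℕ) (A B : Submodule ℝ L)
      (hA : (LieAlgebra.derivedSeries ℝ L k : Submodule ℝ L) ≤ A)
      (hAB : ∀ x ∈ A, ∀ y ∈ A, ⁅x, y⁆ ∈ B) :
      (LieAlgebra.derivedSeries ℝ L (k + 1) : Submodule ℝ L) ≤ B := by
    rw [LieAlgebra.derivedSeries_def, LieAlgebra.derivedSeriesOfIdeal_succ,
      LieIdeal.toLieSubalgebra_toSubmodule, LieSubmodule.lieIdeal_oper_eq_linear_span',
      Submodule.span_le]
    rintro _ ⟨x, hx, y, hy, rfl⟩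
    exact hAB x (hA hx) y (hA hy)
  have h1 := step 0 ⊤ P le_top (fun x _ y _ => hP x y)
  have h3 := step 2 Q ⊥ (step 1 P Q h1 hQ) (fun x hx y hy => by simp [h0 x hx y hy])
  refine LieAlgebra.IsSolvable.mk (R := ℝ) (k := 3) ?_
  rw [← LieSubmodule.toSubmodule_eq_bot]
  exact le_bot_iff.mp h3

namespace BracketTable

/-- The vectors whose coordinates with index in `s` vanish. -/
def coordSubmodule (B : BracketTable) (s : Set (Fin 5)) : Submodule ℝ B.Algebra :=
  Submodule.pi (φ := fun _ => ℝ) s (fun _ => ⊥)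

theorem isSolvable_of_coord (B : BracketTable) (s t : Set (Fin 5))
    (hs : ∀ x y : Fin 5 → ℝ, ∀ i ∈ s, tableBracket B.T x y i = 0)
    (ht : ∀ x y : Fin 5 → ℝ, (∀ i ∈ s, x i = 0) → (∀ i ∈ s, y i = 0) →
      ∀ i ∈ t, tableBracket B.T x y i = 0)
    (h0 : ∀ x y : Fin 5 → ℝ, (∀ i ∈ t, x i = 0) → (∀ i ∈ t, y i = 0) → tableBracket B.T x y = 0) :
    LieAlgebra.IsSolvable B.Algebra :=
  isSolvable_of_chain (B.coordSubmodule s) (B.coordSubmodule t)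
    (fun x y i hi => hs x y i hi) (fun x hx y hy i hi => ht x y hx hy i hi)
    (fun x hx y hy => h0 x y hx hy)

theorem isSolvable_h2 : LieAlgebra.IsSolvable h2.Algebra := by
  refine h2.isSolvable_of_coord {4} {1, 2, 3, 4} ?_ ?_ ?_ <;>
    simp +contextual [h2, h2_bracket]

theorem isSolvable_h3 : LieAlgebra.IsSolvable h3.Algebra := by
  refine h3.isSolvable_of_coord {3, 4} {1, 2, 3, 4} ?_ ?_ ?_ <;>
    simp +contextual [h3, h3_bracket]

theorem isSolvable_h4 : LieAlgebra.IsSolvable h4.Algebra := by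
  refine h4.isSolvable_of_coord {3, 4} {3, 4} ?_ ?_ ?_ <;>
    simp +contextual [h4, h4_bracket]

theorem isSolvable_h5 : LieAlgebra.IsSolvable h5.Algebra := by
  refine h5.isSolvable_of_coord {4} {2, 3, 4} ?_ ?_ ?_ <;>
    simp +contextual [h5, h5_bracket]

theorem isNilpotent_h1 : LieRing.IsNilpotent h1.Algebra := by
  rw [LieRing.IsNilpotent, LieModule.isNilpotent_iff ℝ]
  refine ⟨2, ?_⟩
  rw [LieModule.lowerCentralSeries_succ, LieSubmodule.lie_eq_bot_iff]
  have hle : LieModule.lowerCentralSeries ℝ h1.Algebra h1.Algebra 1 ≤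
      LieAlgebra.center ℝ h1.Algebra := by
    rw [LieModule.lowerCentralSeries_succ, LieSubmodule.lie_le_iff]
    intro x _ y _
    rw [LieModule.mem_maxTrivSubmodule]
    intro z
    have h (x y z : Fin 5 → ℝ) : tableBracket h1Table z (tableBracket h1Table x y) = 0 := by
      simp [h1_bracket]
    exact h x y z
  exact fun x _ y hy => (LieModule.mem_maxTrivSubmodule ℝ _ _ y).mp (hle hy) x

theorem center_eq_bot (B : BracketTable)
    (h : ∀ x : Fin 5 → ℝ, (∀ i, tableBracket B.T (stdVec i) x = 0) → x = 0) :
    LieAlgebra.center ℝ B.Algebra = ⊥ := by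
  rw [LieSubmodule.eq_bot_iff]
  intro x hx
  rw [LieModule.mem_maxTrivSubmodule] at hx
  exact h x fun i => hx (stdVec i)

theorem not_isNilpotent_of_center_eq_bot (B : BracketTable)
    (h : LieAlgebra.center ℝ B.Algebra = ⊥) : ¬ LieRing.IsNilpotent B.Algebra := by
  intro hn
  have : Nontrivial B.Algebra := inferInstanceAs (Nontrivial (Fin 5 → ℝ))
  have := LieAlgebra.non_trivial_center_of_isNilpotent (R := ℝ) (L := B.Algebra)
  rw [h] at this
  exact not_subsingleton _ (inferInstance : Subsingleton (⊥ : LieIdeal ℝ B.Algebra))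

theorem center_h2 : LieAlgebra.center ℝ h2.Algebra = ⊥ := by
  refine center_eq_bot _ fun x hx => ?_
  have h0 := hx 0
  have h1 := hx 1
  have h3 := hx 3
  have h4 := hx 4
  simp [h2, h2_bracket, stdVec] at h0 h1 h3 h4
  funext i
  fin_cases i <;> simp_all

theorem center_h3 : LieAlgebra.center ℝ h3.Algebra = ⊥ := by
  refine center_eq_bot _ fun x hx => ?_
  have h1 := hx 1
  have h2 := hx 2
  have h3' := hx 3
  simp [h3, h3_bracket, stdVec] at h1 h2 h3'
  funext i
  fin_cases i <;> simp_all

theorem center_h4 : LieAlgebra.center ℝ h4.Algebra = ⊥ := by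
  refine center_eq_bot _ fun x hx => ?_
  have h0 := hx 0
  have h1 := hx 1
  have h3 := hx 3
  have h4' := hx 4
  simp [h4, h4_bracket, stdVec] at h0 h1 h3 h4'
  funext i
  fin_cases i <;> simp_all

theorem center_h5 : LieAlgebra.center ℝ h5.Algebra = ⊥ := by
  refine center_eq_bot _ fun x hx => ?_
  have h1 := hx 1
  have h2 := hx 2
  have h3 := hx 3
  have h4 := hx 4
  simp [h5, h5_bracket, stdVec] at h1 h2 h3 h4
  funext i
  fin_cases i <;> simp_all

end BracketTable

theorem theorem1p1 :
    (∀ (L : Type*) [LieRing L] [LieAlgebra ℝ L],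
      Module.finrank ℝ L = 5 → LieAlgebra.IsSolvable L →
        (Nonempty (HypoContactStructure L) ↔
          (Nonempty (L ≃ₗ⁅ℝ⁆ h1.Algebra) ∨ Nonempty (L ≃ₗ⁅ℝ⁆ h2.Algebra) ∨
            Nonempty (L ≃ₗ⁅ℝ⁆ h3.Algebra) ∨ Nonempty (L ≃ₗ⁅ℝ⁆ h4.Algebra) ∨
            Nonempty (L ≃ₗ⁅ℝ⁆ h5.Algebra)))) ∧
    (LieAlgebra.IsSolvable h1.Algebra ∧ LieAlgebra.IsSolvable h2.Algebra ∧
      LieAlgebra.IsSolvable h3.Algebra ∧ LieAlgebra.IsSolvable h4.Algebra ∧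
      LieAlgebra.IsSolvable h5.Algebra) ∧
    (LieRing.IsNilpotent h1.Algebra ∧ ¬ LieRing.IsNilpotent h2.Algebra ∧
      ¬ LieRing.IsNilpotent h3.Algebra ∧ ¬ LieRing.IsNilpotent h4.Algebra ∧
      ¬ LieRing.IsNilpotent h5.Algebra) ∧
    (LieAlgebra.center ℝ h2.Algebra = ⊥ ∧ LieAlgebra.center ℝ h3.Algebra = ⊥ ∧
      LieAlgebra.center ℝ h4.Algebra = ⊥ ∧ LieAlgebra.center ℝ h5.Algebra = ⊥) := by
  refine ⟨fun L _ _ hdim hsol => ?_, ?_, ?_, ?_⟩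
  · simp only [nonempty_lieEquiv_iff]
    constructor
    · rintro ⟨H⟩
      obtain ⟨X, a, b, c, g, p, q, l, m, n, u, v, w, h⟩ := exists_adapted hdim H
      exact h.hasBrackets_of_isSolvable
    · rintro (h | h | h | h | h)
      · obtain ⟨X, hX⟩ := h.exists_adapted_h1
        exact hX.hypoContactStructure
      · obtain ⟨X, hX⟩ := h.exists_adapted_h2
        exact hX.hypoContactStructure
      · obtain ⟨X, hX⟩ := h.exists_adapted_h3
        exact hX.hypoContactStructure
      · obtain ⟨X, hX⟩ := h.exists_adapted_h4
        exact hX.hypoContactStructure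
      · obtain ⟨X, hX⟩ := h.exists_adapted_h5
        exact hX.hypoContactStructure
  · have := BracketTable.isNilpotent_h1
    exact ⟨inferInstance, BracketTable.isSolvable_h2, BracketTable.isSolvable_h3,
      BracketTable.isSolvable_h4, BracketTable.isSolvable_h5⟩
  · exact ⟨BracketTable.isNilpotent_h1,
      BracketTable.not_isNilpotent_of_center_eq_bot _ BracketTable.center_h2,
      BracketTable.not_isNilpotent_of_center_eq_bot _ BracketTable.center_h3,
      BracketTable.not_isNilpotent_of_center_eq_bot _ BracketTable.center_h4,
      BracketTable.not_isNilpotent_of_center_eq_bot _ BracketTable.center_h5⟩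
  · exact ⟨BracketTable.center_h2, BracketTable.center_h3, BracketTable.center_h4,
      BracketTable.center_h5⟩
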